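/- **Setting.** Let $y=(n,\bar x_1,\bar x_2,s_1,s_2,r)$ with $n\ge 1$ an integer, $\bar x_1,\bar x_2\in\mathbb R$, $s_1,s_2>0$, $|r|<1$, be the summary of $n$ bivariate normal observations (sample means, root average sums of squares, sample correlation). For $\theta=(\mu_1,\mu_2,\sigma_1,\sigma_2,\rho)$ with $\mu_i\in\mathbb R$, $\sigma_i>0$, $|\rho|<1$ the likelihood is $$f(y\mid\theta)=\bigl(2\pi\sigma_1\sigma_2\sqrt{1-\rho^2}\bigr)^{-n}\exp\Bigl(-\tfrac{n}{2(1-\rho^2)}\Bigl[\tfrac{(\bar x_1-\mu_1)^2}{\sigma_1^2}-2\rho\tfrac{(\bar x_1-\mu_1)(\bar x_2-\mu_2)}{\sigma_1\sigma_2}+\tfrac{(\bar x_2-\mu_2)^2}{\sigma_2^2}+\tfrac{s_1^2}{\sigma_1^2}-2\rho\tfrac{r s_1s_2}{\sigma_1\sigma_2}+\tfrac{s_2^2}{\sigma_2^2}\Bigr]\Bigr).$$ For real $\alpha,\beta,\gamma,\delta$ and a constant $C>0$ the (possibly improper) prior is $\pi_\eta(\theta)=\pi_{\alpha,\beta}(\rho)\,\sigma_1^{\gamma-1}\sigma_2^{\delta-1}$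 with $\pi_{\alpha,\beta}(\rho)=\frac1C(1-\rho^2)^{\alpha-1}(1+\rho^2)^{\beta/2}$. Write $\mathcal B(u,v)=\Gamma(u)\Gamma(v)/\Gamma(u+v)$, $(x)_m=x(x+1)\cdots(x+m-1)$, and ${}_2F_1$ for Gauss' hypergeometric function (the sum of its series for $|z|<1$, continued analytically to real $z\le -1$). Put $$W=\frac{\Gamma(\frac{n-\gamma}2)\Gamma(\frac{n-\delta}2)}{\Gamma(\frac{n-\gamma-1}2)\Gamma(\frac{n-\delta-1}2)},\qquad A(\rho)=(1-\rho^2)^{\frac{n-\gamma-\delta-1}2}{}_2F_1\bigl(\tfrac{n-\gamma-1}2,\tfrac{n-\delta-1}2;\tfrac12;r^2\rho^2\bigr),$$ $$B(\rho)=2r\rho\,(1-\rho^2)^{\frac{n-\gamma-\delta-1}2}\,W\,{}_2F_1\bigl(\tfrac{n-\gamma}2,\tfrac{n-\delta}2;\tfrac32;r^2\rho^2\bigr),\qquad h=A+B,\qquad p(n,r)=\int_{-1}^1 h(\rho)\,\pi_{\alpha,\beta}(\rho)\,d\rho .$$ Let $p_{\gamma,\delta}(y_0)$ be the integral of $f(y\mid\theta)\sigma_1^{\gamma-1}\sigma_2^{\delta-1}$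 at $\rho=0$ over $(\mu_1,\mu_2,\sigma_1,\sigma_2)$, and $p_\eta(y)$ the integral of $f(y\mid\theta)\pi_\eta(\theta)$ over all of $\theta$. The posterior of $\theta$ has density $f(y\mid\theta)\pi_\eta(\theta)/p_\eta(y)$, and $E(\rho^k\mid n,r)$ is the $k$th moment of its $\rho$-marginal. **Corollary (Characterization of the marginal posteriors of $\rho$).** Assume $n>\gamma+1$, $n>\delta+1$ and $n>\gamma+\delta-2\alpha+1$. 1. If $\alpha>0$, then $C_{\alpha,\beta}=\mathcal B(\frac12,\alpha)\,{}_2F_1(-\frac\beta2,\frac12;\alpha+\frac12;-1)$ is positive, and $\pi_{\alpha,\beta}$ with $C=C_{\alpha,\beta}$ integrates to $1$ over $(-1,1)$. 2. The integrals defining $p_\eta(y)$ and $p_{\gamma,\delta}(y_0)$ converge, $p_\eta(y)=p_{\gamma,\delta}(y_0)\,p(n,r)$, and $$p_{\gamma,\delta}(y_0)=2^{\frac{-\gamma-\delta-4}2}\tfrac{\pi^{1-n}}n(ns_1^2)^{\frac{1+\gamma-n}2}(ns_2^2)^{\frac{1+\delta-n}2}\Gamma(\tfrac{n-\gamma-1}2)\Gamma(\tfrac{n-\delta-1}2).$$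 3. $A\pi_{\alpha,\beta}$ and $B\pi_{\alpha,\beta}$ are integrable on $(-1,1)$, $\int_{-1}^1B\pi_{\alpha,\beta}\,d\rho=0$, and $p(n,r)=\int_{-1}^1A\,\pi_{\alpha,\beta}\,d\rho>0$. 4. The marginal posterior of $\rho$ is the probability measure on $(-1,1)$ with density $h(\rho)\pi_{\alpha,\beta}(\rho)/p(n,r)$. 5. For every integer $k\ge0$ the moment $E(\rho^k\mid n,r)$ exists and equals $\frac1{p(n,r)}\int_{-1}^1\rho^kA\,\pi_{\alpha,\beta}\,d\rho$ if $k$ is even and $\frac1{p(n,r)}\int_{-1}^1\rho^kB\,\pi_{\alpha,\beta}\,d\rho$ if $k$ is odd. Moreover $$E(\rho^k\mid n,r)=\begin{cases}\dfrac1{C\,p(n,r)}\displaystyle\sum_{m\ge0}\frac{(\frac{n-\gamma-1}2)_m(\frac{n-\delta-1}2)_m}{(\frac12)_m\,m!}\,a_{k,m}\,r^{2m}&k\text{ even},\\[2ex]\dfrac{2W}{C\,p(n,r)}\displaystyle\sum_{m\ge0}\frac{(\frac{n-\gamma}2)_m(\frac{n-\delta}2)_m}{(\frac32)_m\,m!}\,b_{k,m}\,r^{2m+1}&k\text{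 odd},\end{cases}$$ with convergent series, where $$a_{k,m}=\mathcal B\bigl(\tfrac{k+2m+1}2,\alpha+\tfrac{n-\gamma-\delta-1}2\bigr)\,{}_2F_1\bigl(-\tfrac\beta2,\tfrac{k+2m+1}2;\tfrac{k+2m+2\alpha+n-\gamma-\delta}2;-1\bigr),$$ $$b_{k,m}=\mathcal B\bigl(\tfrac{k+2m+2}2,\alpha+\tfrac{n-\gamma-\delta-1}2\bigr)\,{}_2F_1\bigl(-\tfrac\beta2,\tfrac{k+2m+2}2;\tfrac{k+2m+2\alpha+n-\gamma-\delta+1}2;-1\bigr).$$ 6. If $\beta/2$ is a non-negative integer, these series are hypergeometric: the ratio of consecutive coefficients is a rational function of $m$. -/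

import Mathlib

open MeasureTheory Set Filter Topology

noncomputable section

namespace CorrPosterior

/-! ### Gauss' hypergeometric function -/

/-- `w` is the value at the real point `z` of the analytic continuation of the Gauss series
`∑ (a)_m (b)_m / ((c)_m m!) x^m` (Mathlib's `ordinaryHypergeometric`, meaningful for `|x| < 1`)
from the origin along the segment from `0` to `z`. -/
def IsGaussValue (a b c z w : ℝ) : Prop :=
  ∃ f : ℝ → ℝ, AnalyticOnNhd ℝ f (segment ℝ 0 z) ∧
    f =ᶠ[𝓝 0] (fun x : ℝ => ordinaryHypergeometric a b c x) ∧ f z = w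

/-- The continued value is unique. -/
theorem IsGaussValue.unique {a b c z w w' : ℝ} (h : IsGaussValue a b c z w)
    (h' : IsGaussValue a b c z w') : w = w' := by
  obtain ⟨f, hf, hf0, rfl⟩ := h
  obtain ⟨g, hg, hg0, rfl⟩ := h'
  exact hf.eqOn_of_preconnected_of_eventuallyEq hg (convex_segment 0 z).isPreconnected
    (left_mem_segment ℝ 0 z) (hf0.trans hg0.symm) (right_mem_segment ℝ 0 z)

open Classical in
/-- Gauss' hypergeometric function `₂F₁(a, b; c; z)` for real parameters and real `z < 1`: the sum
of the Gauss series for `|z| < 1`, and its analytic continuation for `z ≤ -1`, in particular at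
`z = -1`, where the series itself need not converge. -/
def gauss2F1 (a b c z : ℝ) : ℝ :=
  if h : ∃ w, IsGaussValue a b c z w then h.choose else 0

theorem gauss2F1_eq {a b c z w : ℝ} (h : IsGaussValue a b c z w) : gauss2F1 a b c z = w := by
  have hex : ∃ w, IsGaussValue a b c z w := ⟨w, h⟩
  rw [gauss2F1, dif_pos hex]
  exact hex.choose_spec.unique h

/-- The Pochhammer symbol `(x)_m = x (x+1) ⋯ (x+m-1)`. -/
def poch (x : ℝ) (m : ℕ) : ℝ := (ascPochhammer ℝ m).eval x

/-- A sequence `c` is hypergeometric if `c (m+1) / c m` is a rational function of `m`. -/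
def IsHypergeometricSeq (c : ℕ → ℝ) : Prop :=
  ∃ P Q : Polynomial ℝ, ∀ m : ℕ,
    Q.eval (m : ℝ) ≠ 0 ∧ Q.eval (m : ℝ) * c (m + 1) = P.eval (m : ℝ) * c m

/-! ### The bivariate normal model, the prior and the posterior -/

/-- The summary `y = (n, x̄₁, x̄₂, s₁, s₂, r)` of `n` pairs of observations. -/
structure Summary where
  n : ℕ
  xbar1 : ℝ
  xbar2 : ℝ
  s1 : ℝ
  s2 : ℝ
  r : ℝ

/-- Nuisance parameters `θ₀ = (μ₁, μ₂, σ₁, σ₂)`. -/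
abbrev Nuisance : Type := ℝ × ℝ × ℝ × ℝ

/-- The range of the nuisance parameters: `μ₁, μ₂ ∈ ℝ` and `σ₁, σ₂ > 0`. -/
def nuisanceSet : Set Nuisance := univ ×ˢ univ ×ˢ Ioi 0 ×ˢ Ioi 0

/-- The range of the full parameter `θ = (θ₀, ρ)`, with `ρ ∈ (-1, 1)`. -/
def paramSet : Set (Nuisance × ℝ) := nuisanceSet ×ˢ Ioo (-1) 1

/-- The bivariate normal likelihood `f(y | θ₀, ρ)`. -/
def likelihood (y : Summary) : Nuisance → ℝ → ℝ
  | (μ1, μ2, σ1, σ2), ρ =>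
    ((2 * Real.pi * σ1 * σ2 * √(1 - ρ ^ 2)) ^ y.n)⁻¹ *
      Real.exp (-(y.n / (2 * (1 - ρ ^ 2))) *
        ((y.xbar1 - μ1) ^ 2 / σ1 ^ 2
          - 2 * ρ * ((y.xbar1 - μ1) * (y.xbar2 - μ2) / (σ1 * σ2))
          + (y.xbar2 - μ2) ^ 2 / σ2 ^ 2)) *
      Real.exp (-(y.n / (2 * (1 - ρ ^ 2))) *
        ((y.s1 / σ1) ^ 2 - 2 * ρ * (y.r * y.s1 * y.s2 / (σ1 * σ2)) + (y.s2 / σ2) ^ 2))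

/-- The prior `π_γ(σ₁) π_δ(σ₂) = σ₁^(γ-1) σ₂^(δ-1)` on the nuisance parameters (flat in the
means). -/
def priorNuisance (γ δ : ℝ) : Nuisance → ℝ
  | (_, _, σ1, σ2) => σ1 ^ (γ - 1) * σ2 ^ (δ - 1)

/-- The prior `π_{α,β}(ρ) = (1-ρ²)^(α-1) (1+ρ²)^(β/2) / C` on `ρ`, with scaling constant `C`. -/
def priorRho (C α β ρ : ℝ) : ℝ :=
  (1 - ρ ^ 2) ^ (α - 1) * (1 + ρ ^ 2) ^ (β / 2) / C

/-- `C_{α,β} = B(1/2, α) ₂F₁(-β/2, 1/2; α + 1/2; -1)`. -/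
def priorConst (α β : ℝ) : ℝ :=
  ProbabilityTheory.beta (1 / 2) α * gauss2F1 (-β / 2) (1 / 2) (α + 1 / 2) (-1)

/-- Likelihood times prior, `f(y | θ) π_η(θ)`. -/
def joint (y : Summary) (C α β γ δ : ℝ) (θ : Nuisance × ℝ) : ℝ :=
  likelihood y θ.1 θ.2 * (priorRho C α β θ.2 * priorNuisance γ δ θ.1)

/-- The marginal likelihood `p_η(y)`: all parameters integrated out. -/
def marginalLikelihood (y : Summary) (C α β γ δ : ℝ) : ℝ :=
  ∫ θ in paramSet, joint y C α β γ δ θ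

/-- `p_{γ,δ}(y₀)`: the marginal likelihood with `ρ` fixed at zero. -/
def nullMarginalLikelihood (y : Summary) (γ δ : ℝ) : ℝ :=
  ∫ θ₀ in nuisanceSet, likelihood y θ₀ 0 * priorNuisance γ δ θ₀

/-- The posterior distribution of `θ = (θ₀, ρ)` given `y` (Bayes' rule). -/
def posterior (y : Summary) (C α β γ δ : ℝ) : Measure (Nuisance × ℝ) :=
  (volume.restrict paramSet).withDensity fun θ =>
    ENNReal.ofReal (joint y C α β γ δ θ / marginalLikelihood y C α β γ δ)

/-- The marginal posterior distribution of `ρ`. -/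
def marginalPosterior (y : Summary) (C α β γ δ : ℝ) : Measure ℝ :=
  (posterior y C α β γ δ).map Prod.snd

/-- The `k`th posterior moment `E(ρ^k | y)`. -/
def posteriorMoment (y : Summary) (C α β γ δ : ℝ) (k : ℕ) : ℝ :=
  ∫ ρ, ρ ^ k ∂(marginalPosterior y C α β γ δ)

/-! ### The reduced likelihood -/

/-- `W_{γ,δ}(n)`. -/
def ratioW (n : ℕ) (γ δ : ℝ) : ℝ :=
  (Real.Gamma ((n - γ) / 2) * Real.Gamma ((n - δ) / 2)) /
    (Real.Gamma ((n - γ - 1) / 2) * Real.Gamma ((n - δ - 1) / 2))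

/-- The even part `A_{γ,δ}(n, r | ρ)`. -/
def partA (n : ℕ) (r γ δ ρ : ℝ) : ℝ :=
  (1 - ρ ^ 2) ^ ((n - γ - δ - 1) / 2) *
    gauss2F1 ((n - γ - 1) / 2) ((n - δ - 1) / 2) (1 / 2) (r ^ 2 * ρ ^ 2)

/-- The odd part `B_{γ,δ}(n, r | ρ)`. -/
def partB (n : ℕ) (r γ δ ρ : ℝ) : ℝ :=
  2 * r * ρ * (1 - ρ ^ 2) ^ ((n - γ - δ - 1) / 2) * ratioW n γ δ *
    gauss2F1 ((n - γ) / 2) ((n - δ) / 2) (3 / 2) (r ^ 2 * ρ ^ 2)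

/-- The reduced likelihood `h_{γ,δ}(n, r | ρ) = A + B`. -/
def reducedLikelihood (n : ℕ) (r γ δ ρ : ℝ) : ℝ :=
  partA n r γ δ ρ + partB n r γ δ ρ

/-- `p^{γ,δ}_{α,β}(n, r) = ∫ h_{γ,δ}(n, r | ρ) π_{α,β}(ρ) dρ`. -/
def normConst (n : ℕ) (r C α β γ δ : ℝ) : ℝ :=
  ∫ ρ in (-1 : ℝ)..1, reducedLikelihood n r γ δ ρ * priorRho C α β ρ

/-! ### The coefficients of the moment series -/

/-- `a_{k,m}`. -/
def coeffa (n : ℕ) (α β γ δ : ℝ) (k m : ℕ) : ℝ :=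
  ProbabilityTheory.beta (1 / 2 + (k + 2 * m) / 2) (α + (n - γ - δ - 1) / 2) *
    gauss2F1 (-β / 2) ((k + 2 * m + 1) / 2) ((k + 2 * m + 2 * α + n - γ - δ) / 2) (-1)

/-- `b_{k,m}`. -/
def coeffb (n : ℕ) (α β γ δ : ℝ) (k m : ℕ) : ℝ :=
  ProbabilityTheory.beta (1 / 2 + (k + 2 * m + 1) / 2) (α + (n - γ - δ - 1) / 2) *
    gauss2F1 (-β / 2) ((k + 2 * m + 2) / 2) ((k + 2 * m + 2 * α + n - γ - δ + 1) / 2) (-1)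

/-- Coefficient of `r^(2m)` in the even-moment series. -/
def evenCoeff (n : ℕ) (α β γ δ : ℝ) (k m : ℕ) : ℝ :=
  poch ((n - γ - 1) / 2) m * poch ((n - δ - 1) / 2) m / (poch (1 / 2) m * m.factorial) *
    coeffa n α β γ δ k m

/-- Coefficient of `r^(2m+1)` in the odd-moment series. -/
def oddCoeff (n : ℕ) (α β γ δ : ℝ) (k m : ℕ) : ℝ :=
  poch ((n - γ) / 2) m * poch ((n - δ) / 2) m / (poch (3 / 2) m * m.factorial) *
    coeffb n α β γ δ k m

end CorrPosterior

end

namespace CorrPosterior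

/-! ### Pochhammer symbols and the Gauss series -/

/-! Everything rests on one computation at fixed `ρ` (`lintegral_nuisance`). The means enter through
a bivariate Gaussian and integrate out by completing the square. In the remaining integral over the
scales, only the factor `exp (2κ c s1 s2 / (σ1 σ2))` with `c = rρ` couples `σ1` and `σ2`. Expanding
it in powers makes each term a product of two Gamma integrals, so the result is a multiple of `∑
(2c)^j / j! Γ(a + j/2) Γ(b + j/2)`. Even and odd `j` give the two Gauss series in `A` and `B`
(`integral_scaleIntegrand`, `hasSum_gammaSeries`). Hence the nuisance integral is `nullConst *
h(ρ)`, and `h(0) = 1` identifies the constant as the null marginal likelihood. As all integrands are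
nonnegative, Tonelli then yields the marginal likelihood and the density of `ρ`.

The prior and `A` are even and `B` is odd, so each moment keeps only one part. The power of `1 - ρ²`
in `h` merges with the prior into `rhoWeight` of exponent `e = α + (n-γ-δ-1)/2`, and `e > 0` is
precisely the third inequality assumed on `n`. Substituting `t = ρ²` and integrating the Gauss
series termwise (`hasSum_integral_gauss2F1`) leaves Euler integrals of `(1 + t)^(β/2)`, that is,
values of `₂F₁` at `-1`. There the series may diverge; Pfaff's transformation `z ↦ z/(z-1)` supplies
the continuation (`integral_betaWeight_mul_one_add_rpow`).

If `β = 2j`, expanding `(1 + t)^j` turns the Euler value into a Beta function times a rational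
function of `m`, whence the rational ratios. -/

theorem poch_zero (x : ℝ) : poch x 0 = 1 := by simp [poch]

theorem poch_succ (x : ℝ) (m : ℕ) : poch x (m + 1) = poch x m * (x + m) := by
  simp [poch, ascPochhammer_succ_eval]

theorem poch_pos {x : ℝ} (hx : 0 < x) (m : ℕ) : 0 < poch x m := by
  induction m with
  | zero => simp [poch_zero]
  | succ m ih => rw [poch_succ]; positivity

theorem Gamma_add_natCast {x : ℝ} (hx : 0 < x) (m : ℕ) :
    Real.Gamma (x + m) = poch x m * Real.Gamma x := by
  induction m with
  | zero => simp [poch_zero]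
  | succ m ih =>
    rw [Nat.cast_succ, ← add_assoc, Real.Gamma_add_one (by positivity), ih, poch_succ]; ring

theorem beta_add_natCast {b e : ℝ} (hb : 0 < b) (he : 0 < e) (m : ℕ) :
    ProbabilityTheory.beta (b + m) e =
      poch b m / poch (b + e) m * ProbabilityTheory.beta b e := by
  have h : b + m + e = b + e + m := by ring
  simp only [ProbabilityTheory.beta]
  rw [h, Gamma_add_natCast hb, Gamma_add_natCast (by positivity : 0 < b + e)]
  have := (poch_pos (by positivity : 0 < b + e) m).ne'
  have := (Real.Gamma_pos_of_pos (by positivity : 0 < b + e)).ne'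
  field_simp

theorem beta_comm (b e : ℝ) : ProbabilityTheory.beta b e = ProbabilityTheory.beta e b := by
  simp only [ProbabilityTheory.beta, add_comm, mul_comm]

/-- The coefficients of the Gauss series. -/
noncomputable def gaussCoeff (a b c : ℝ) (m : ℕ) : ℝ :=
  poch a m * poch b m / (poch c m * m.factorial)

theorem gaussCoeff_pos {a b c : ℝ} (ha : 0 < a) (hb : 0 < b) (hc : 0 < c) (m : ℕ) :
    0 < gaussCoeff a b c m := by
  have := poch_pos ha m; have := poch_pos hb m; have := poch_pos hc m
  unfold gaussCoeff; positivity

/-- The series terminates, with infinite radius, when `a` or `b` is a nonpositive integer; otherwise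
the radius is one, `c > 0` excluding zero denominators. -/
theorem one_le_radius_ordinaryHypergeometricSeries (a b : ℝ) {c : ℝ} (hc : 0 < c) :
    1 ≤ (ordinaryHypergeometricSeries ℝ a b c).radius := by
  by_cases ha : ∃ k : ℕ, (k : ℝ) = -a
  · obtain ⟨k, hk⟩ := ha
    rw [show a = -(k : ℝ) by linarith, ordinaryHypergeometric_radius_top_of_neg_nat₁]
    exact le_top
  by_cases hb : ∃ k : ℕ, (k : ℝ) = -b
  · obtain ⟨k, hk⟩ := hb
    rw [show b = -(k : ℝ) by linarith, ordinaryHypergeometric_radius_top_of_neg_nat₂]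
    exact le_top
  rw [ordinaryHypergeometricSeries_radius_eq_one]
  push Not at ha hb
  exact fun k => ⟨ha k, hb k, fun h => by have := k.cast_nonneg (α := ℝ); linarith⟩

theorem hasFPowerSeriesOnBall_ordinaryHypergeometric (a b : ℝ) {c : ℝ} (hc : 0 < c) :
    HasFPowerSeriesOnBall (fun x : ℝ => ordinaryHypergeometric a b c x)
      (ordinaryHypergeometricSeries ℝ a b c) 0 1 := by
  have h := one_le_radius_ordinaryHypergeometricSeries a b hc
  exact ((ordinaryHypergeometricSeries ℝ a b c).hasFPowerSeriesOnBall
    (one_pos.trans_le h)).mono one_pos h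

theorem analyticAt_ordinaryHypergeometric (a b : ℝ) {c z : ℝ} (hc : 0 < c) (hz : |z| < 1) :
    AnalyticAt ℝ (fun x : ℝ => ordinaryHypergeometric a b c x) z :=
  (hasFPowerSeriesOnBall_ordinaryHypergeometric a b hc).analyticAt_of_mem
    (by simpa [← ofReal_norm] using hz)

theorem hasSum_ordinaryHypergeometric (a b : ℝ) {c z : ℝ} (hc : 0 < c) (hz : |z| < 1) :
    HasSum (fun m => gaussCoeff a b c m * z ^ m) (ordinaryHypergeometric a b c z) := by
  have h := (hasFPowerSeriesOnBall_ordinaryHypergeometric a b hc).hasSum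
    (y := z) (by simpa [← ofReal_norm] using hz)
  rw [zero_add] at h
  convert! h using 2 with m
  rw [ordinaryHypergeometricSeries_apply_eq, gaussCoeff, smul_eq_mul]
  simp only [poch, div_eq_mul_inv, mul_inv]
  ring

/-- The segment from `0` to `z` stays in the unit disc, so the sum of the series is its own
continuation. -/
theorem gauss2F1_eq_ordinaryHypergeometric (a b : ℝ) {c z : ℝ} (hc : 0 < c) (hz : |z| < 1) :
    gauss2F1 a b c z = ordinaryHypergeometric a b c z := by
  refine gauss2F1_eq ⟨_, fun x hx => analyticAt_ordinaryHypergeometric a b hc ?_,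
    EventuallyEq.rfl, rfl⟩
  have := (convex_ball (0 : ℝ) 1).segment_subset (by simp) (by simpa using hz) hx
  simpa using this

theorem hasSum_gauss2F1 (a b : ℝ) {c z : ℝ} (hc : 0 < c) (hz : |z| < 1) :
    HasSum (fun m => gaussCoeff a b c m * z ^ m) (gauss2F1 a b c z) := by
  rw [gauss2F1_eq_ordinaryHypergeometric a b hc hz]
  exact hasSum_ordinaryHypergeometric a b hc hz

theorem continuousAt_gauss2F1 (a b : ℝ) {c z : ℝ} (hc : 0 < c) (hz : |z| < 1) :
    ContinuousAt (gauss2F1 a b c) z := by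
  refine (analyticAt_ordinaryHypergeometric a b hc hz).continuousAt.congr ?_
  filter_upwards [(isOpen_Iio.preimage continuous_abs).mem_nhds hz] with x hx
  exact (gauss2F1_eq_ordinaryHypergeometric a b hc hx).symm

theorem one_le_gauss2F1 {a b c z : ℝ} (ha : 0 < a) (hb : 0 < b) (hc : 0 < c) (hz : 0 ≤ z)
    (hz1 : z < 1) : 1 ≤ gauss2F1 a b c z := by
  have h := hasSum_gauss2F1 a b hc (by rwa [abs_of_nonneg hz] : |z| < 1)
  have := le_hasSum h 0 fun m _ => mul_nonneg (gaussCoeff_pos ha hb hc m).le (pow_nonneg hz m)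
  simpa [gaussCoeff, poch_zero] using this

/-- The binomial series. -/
theorem hasSum_one_sub_rpow (a : ℝ) {x : ℝ} (hx : |x| < 1) :
    HasSum (fun m : ℕ => poch a m / m.factorial * x ^ m) ((1 - x) ^ (-a)) := by
  have h := (Real.one_add_rpow_hasFPowerSeriesOnBall_zero (a := -a)).hasSum
    (y := -x) (by simpa [← ofReal_norm] using hx)
  -- The binomial series is the Gauss series with equal second and third parameters; their common
  -- value `1` is an arbitrary admissible choice and cancels below.
  rw [binomialSeries_eq_ordinaryHypergeometricSeries (b := (1 : ℝ))
    (fun k hk => by have := k.cast_nonneg (α := ℝ); linarith)] at h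
  rw [zero_add, ← sub_eq_add_neg] at h
  convert! h using 2 with m
  rw [FormalMultilinearSeries.compContinuousLinearMap_apply]
  have : (⇑(-ContinuousLinearMap.id ℝ ℝ) ∘ fun _ : Fin m => -x) = fun _ => x := by
    ext; simp
  rw [this, ordinaryHypergeometricSeries_apply_eq, neg_neg, smul_eq_mul]
  have h1 : (ascPochhammer ℝ m).eval 1 ≠ 0 := (poch_pos one_pos m).ne'
  simp only [poch]
  field_simp

/-! ### Euler's integral -/

/-- The weight of Euler's integral. -/
noncomputable def betaWeight (b e t : ℝ) : ℝ := t ^ (b - 1) * (1 - t) ^ (e - 1)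

theorem betaWeight_pos {b e t : ℝ} (ht : t ∈ Ioo (0 : ℝ) 1) : 0 < betaWeight b e t :=
  mul_pos (Real.rpow_pos_of_pos ht.1 _) (Real.rpow_pos_of_pos (sub_pos.2 ht.2) _)

theorem integral_betaWeight {b e : ℝ} (hb : 0 < b) (he : 0 < e) :
    ∫ t in Ioo (0 : ℝ) 1, betaWeight b e t = ProbabilityTheory.beta b e := by
  have h := ProbabilityTheory.lintegral_betaPDF_eq_one hb he
  have hB := ProbabilityTheory.beta_pos hb he
  rw [ProbabilityTheory.lintegral_betaPDF, ← ENNReal.toReal_eq_one_iff,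
    ← integral_eq_lintegral_of_nonneg_ae] at h
  · simp_rw [mul_assoc, integral_const_mul] at h
    rw [one_div, inv_mul_eq_one₀ hB.ne'] at h
    exact h.symm
  · refine ae_restrict_of_forall_mem measurableSet_Ioo fun t ht => ?_
    have := (betaWeight_pos (b := b) (e := e) ht).le
    rw [betaWeight] at this
    simp only [Pi.zero_apply, mul_assoc]
    positivity
  · exact Measurable.aestronglyMeasurable (by fun_prop)

/-- A non-integrable function has Bochner integral zero by convention, so the nonzero value just
computed already gives integrability. The scale integrals below use the same device. -/
theorem integrableOn_betaWeight {b e : ℝ} (hb : 0 < b) (he : 0 < e) :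
    IntegrableOn (betaWeight b e) (Ioo 0 1) :=
  .of_integral_ne_zero (by
    rw [integral_betaWeight hb he]; exact (ProbabilityTheory.beta_pos hb he).ne')

theorem betaWeight_mul_pow {b e t : ℝ} (ht : 0 < t) (m : ℕ) :
    betaWeight b e t * t ^ m = betaWeight (b + m) e t := by
  have : b + m - 1 = (b - 1) + m := by ring
  rw [betaWeight, betaWeight, this, Real.rpow_add_natCast ht.ne']
  ring

/-- Expand `(1 - zt)^(-a)` binomially; since `|zt| ≤ |z| < 1`, termwise integration is dominated.
The factor `t^m` shifts `b` to `b + m`, and the resulting ratio `(b)_m / (b+e)_m` of Beta values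
completes the Gauss coefficient. -/
theorem integral_betaWeight_mul_rpow (a : ℝ) {b e z : ℝ} (hb : 0 < b) (he : 0 < e)
    (hz : |z| < 1) :
    ∫ t in Ioo (0 : ℝ) 1, betaWeight b e t * (1 - z * t) ^ (-a) =
      ProbabilityTheory.beta b e * gauss2F1 a b (b + e) z := by
  have hw := integrableOn_betaWeight hb he
  have habs : Summable fun m : ℕ => |poch a m / m.factorial| * |z| ^ m := by
    refine (hasSum_one_sub_rpow a hz).summable.abs.congr fun m => ?_
    rw [abs_mul, abs_pow]
  have h := hasSum_integral_of_dominated_convergence (μ := volume.restrict (Ioo (0 : ℝ) 1))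
    (F := fun (m : ℕ) t => betaWeight b e t * (poch a m / m.factorial * (z * t) ^ m))
    (f := fun t => betaWeight b e t * (1 - z * t) ^ (-a))
    (fun m t => betaWeight b e t * (|poch a m / m.factorial| * |z| ^ m))
    (fun m => hw.aestronglyMeasurable.mul (by fun_prop))
    (fun m => ae_restrict_of_forall_mem measurableSet_Ioo fun t ht => by
      rw [norm_mul, Real.norm_of_nonneg (betaWeight_pos ht).le, norm_mul, norm_pow, norm_mul]
      simp only [Real.norm_eq_abs]
      have := (betaWeight_pos (b := b) (e := e) ht).le
      have : |z| * |t| ≤ |z| := by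
        rw [abs_of_pos ht.1]; exact mul_le_of_le_one_right (abs_nonneg z) ht.2.le
      gcongr)
    (ae_of_all _ fun t => habs.mul_left _)
    (by simp_rw [tsum_mul_left]; exact hw.mul_const _)
    (ae_restrict_of_forall_mem measurableSet_Ioo fun t ht =>
      (hasSum_one_sub_rpow a (by
        rw [abs_mul, abs_of_pos ht.1]
        exact (mul_le_of_le_one_right (abs_nonneg z) ht.2.le).trans_lt hz)).mul_left _)
  have h2 := (hasSum_gauss2F1 a b (by positivity : 0 < b + e) hz).mul_left
    (ProbabilityTheory.beta b e)
  refine h.unique ?_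
  convert! h2 using 2 with m
  have : ∫ t in Ioo (0 : ℝ) 1, betaWeight b e t * (poch a m / m.factorial * (z * t) ^ m) =
      ∫ t in Ioo (0 : ℝ) 1, (poch a m / m.factorial * z ^ m) * betaWeight (b + m) e t := by
    refine setIntegral_congr_fun measurableSet_Ioo fun t ht => ?_
    rw [← betaWeight_mul_pow ht.1, mul_pow]; ring
  rw [this, integral_const_mul, integral_betaWeight (by positivity) he, beta_add_natCast hb he,
    gaussCoeff]
  have := (poch_pos (by positivity : 0 < b + e) m).ne'
  field_simp

/-- Pfaff's transformation at the level of Euler's integral: replacing `t` by `1 - t` swaps `b` with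
`e` and sends `z` to `z/(z-1)`. -/
theorem integral_betaWeight_mul_rpow_reflect (a b e : ℝ) {z : ℝ} (hz : z < 1) :
    ∫ t in Ioo (0 : ℝ) 1, betaWeight b e t * (1 - z * t) ^ (-a) =
      (1 - z) ^ (-a) *
        ∫ t in Ioo (0 : ℝ) 1, betaWeight e b t * (1 - z / (z - 1) * t) ^ (-a) := by
  simp only [← integral_Ioc_eq_integral_Ioo]
  simp only [← intervalIntegral.integral_of_le zero_le_one]
  have h := intervalIntegral.integral_comp_sub_left (a := 0) (b := 1)
    (fun t => betaWeight e b t * (1 - z / (z - 1) * t) ^ (-a)) 1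
  rw [sub_self, sub_zero] at h
  rw [← h, ← intervalIntegral.integral_const_mul]
  refine intervalIntegral.integral_congr fun t ht => ?_
  rw [uIcc_of_le zero_le_one] at ht
  have hz' : 0 < 1 - z := by linarith
  have h1 : 0 ≤ 1 - z * t := by
    have h2 := ht.1; have h3 := ht.2
    by_cases h0 : 0 ≤ z
    · nlinarith
    · nlinarith
  have h2 : 1 - z / (z - 1) * (1 - t) = (1 - z * t) / (1 - z) := by
    have : z - 1 ≠ 0 := by linarith
    field_simp
    ring
  rw [h2, Real.div_rpow h1 hz'.le, betaWeight, betaWeight]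
  have := (Real.rpow_pos_of_pos hz' (-a)).ne'
  rw [show 1 - (1 - t) = t by ring]
  field_simp

/-- Euler's integral at `z = -1`. -/
theorem integral_betaWeight_mul_one_add_rpow (a : ℝ) {b e : ℝ} (hb : 0 < b) (he : 0 < e) :
    ∫ t in Ioo (0 : ℝ) 1, betaWeight b e t * (1 + t) ^ (-a) =
      ProbabilityTheory.beta b e * gauss2F1 a b (b + e) (-1) := by
  have hB := ProbabilityTheory.beta_pos hb he
  have hc : 0 < b + e := by positivity
  -- The bound `1/2` is exactly the condition for `z/(z-1)` to lie in the unit disc; it covers the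
  -- whole segment from `-1` to `0`.
  have key : ∀ z : ℝ, z < 1 / 2 →
      ∫ t in Ioo (0 : ℝ) 1, betaWeight b e t * (1 - z * t) ^ (-a) =
        ProbabilityTheory.beta b e *
          ((1 - z) ^ (-a) * ordinaryHypergeometric a e (b + e) (z / (z - 1))) := by
    intro z hz
    have hz1 : |z / (z - 1)| < 1 := by
      rw [abs_div, div_lt_one (by rw [abs_pos]; linarith), abs_of_neg (by linarith : z - 1 < 0),
        abs_lt]
      constructor <;> linarith
    rw [integral_betaWeight_mul_rpow_reflect a b e (by linarith),
      integral_betaWeight_mul_rpow a he hb hz1, beta_comm e b, add_comm e b,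
      gauss2F1_eq_ordinaryHypergeometric a e hc hz1]
    ring
  -- The Pfaff form is analytic along the segment, and near `0` it equals the Gauss series because
  -- both are Euler's integral divided by the Beta value. It is therefore the continuation.
  have hval : IsGaussValue a b (b + e) (-1)
      ((1 - (-1)) ^ (-a) * ordinaryHypergeometric a e (b + e) ((-1 : ℝ) / (-1 - 1))) := by
    refine ⟨fun z => (1 - z) ^ (-a) * ordinaryHypergeometric a e (b + e) (z / (z - 1)),
      fun z hz => ?_, ?_, rfl⟩
    · rw [segment_symm, segment_eq_Icc (by norm_num)] at hz
      have hz0 := hz.2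
      have hz1 := hz.1
      have h1 : z - 1 ≠ 0 := by linarith
      refine AnalyticAt.mul ?_ ?_
      · exact ((contDiffAt_const.sub contDiffAt_id).rpow_const_of_ne
          (by simp only [id]; linarith) : ContDiffAt ℝ ⊤ (fun x : ℝ => (1 - x) ^ (-a)) z).analyticAt
      · refine AnalyticAt.fun_comp (g := fun x : ℝ => ordinaryHypergeometric a e (b + e) x)
          (analyticAt_ordinaryHypergeometric a e hc ?_)
          (analyticAt_id.div (analyticAt_id.sub analyticAt_const) h1)
        rw [abs_div, div_lt_one (by rw [abs_pos]; linarith), abs_of_neg (by linarith : z - 1 < 0),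
          abs_lt]
        constructor <;> linarith
    · filter_upwards [Ioo_mem_nhds (by norm_num : (-(1 / 2) : ℝ) < 0)
        (by norm_num : (0 : ℝ) < 1 / 2)] with z hz
      have hz1 : |z| < 1 := by rw [abs_lt]; constructor <;> linarith [hz.1, hz.2]
      have := integral_betaWeight_mul_rpow a hb he hz1
      rw [key z hz.2, gauss2F1_eq_ordinaryHypergeometric a b hc hz1] at this
      exact mul_left_cancel₀ hB.ne' this
  rw [gauss2F1_eq hval, ← key (-1) (by norm_num)]
  simp

/-! ### Moments of the weight `(1 - ρ²)^(e-1) (1 + ρ²)^(β/2)` -/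

/-- The weight `(1 - ρ²)^(e-1) (1 + ρ²)^(β/2)`. -/
noncomputable def rhoWeight (e β ρ : ℝ) : ℝ := (1 - ρ ^ 2) ^ (e - 1) * (1 + ρ ^ 2) ^ (β / 2)

/-- The value `B(b, e) ₂F₁(-β/2, b; b + e; -1)` of Euler's integral. -/
noncomputable def eulerValue (β e b : ℝ) : ℝ :=
  ProbabilityTheory.beta b e * gauss2F1 (-β / 2) b (b + e) (-1)

theorem one_sub_sq_pos {ρ : ℝ} (hρ : ρ ∈ Ioo (-1 : ℝ) 1) : 0 < 1 - ρ ^ 2 := by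
  nlinarith [hρ.1, hρ.2]

theorem rhoWeight_pos {e β ρ : ℝ} (hρ : ρ ∈ Ioo (-1 : ℝ) 1) : 0 < rhoWeight e β ρ :=
  mul_pos (Real.rpow_pos_of_pos (one_sub_sq_pos hρ) _) (Real.rpow_pos_of_pos (by positivity) _)

theorem rhoWeight_neg (e β ρ : ℝ) : rhoWeight e β (-ρ) = rhoWeight e β ρ := by
  simp [rhoWeight]

theorem integral_betaWeight_mul_eq_eulerValue (β : ℝ) {e b : ℝ} (he : 0 < e) (hb : 0 < b) :
    ∫ t in Ioo (0 : ℝ) 1, betaWeight b e t * (1 + t) ^ (β / 2) = eulerValue β e b := by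
  rw [eulerValue, ← integral_betaWeight_mul_one_add_rpow _ hb he]
  simp [neg_div]

theorem integrableOn_betaWeight_mul (β : ℝ) {e b : ℝ} (he : 0 < e) (hb : 0 < b) :
    IntegrableOn (fun t => betaWeight b e t * (1 + t) ^ (β / 2)) (Ioo 0 1) := by
  have h := integrableOn_betaWeight hb he
  rw [← integrableOn_Icc_iff_integrableOn_Ioo] at h ⊢
  refine h.mul_continuousOn (ContinuousOn.rpow_const (by fun_prop) fun t ht => Or.inl ?_)
    isCompact_Icc
  linarith [ht.1]

/-- The substitution `t = ρ²` with its Jacobian. The indicators carry the interval `(0, 1)` along,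
since the power substitution is available on the whole half-line. -/
theorem comp_sq_indicator (e β : ℝ) (l : ℕ) {x : ℝ} (hx : 0 < x) :
    (|(2 : ℝ)| * x ^ ((2 : ℝ) - 1)) • (Ioo (0 : ℝ) 1).indicator
        (fun t => betaWeight (l + 1 / 2) e t * (1 + t) ^ (β / 2)) (x ^ (2 : ℝ)) =
      (Ioo (0 : ℝ) 1).indicator (fun ρ => 2 * (ρ ^ (2 * l) * rhoWeight e β ρ)) x := by
  rw [Real.rpow_two]
  by_cases h : x < 1
  · have h1 : x ∈ Ioo (0 : ℝ) 1 := ⟨hx, h⟩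
    have h2 : x ^ 2 ∈ Ioo (0 : ℝ) 1 := ⟨by positivity, by nlinarith⟩
    rw [indicator_of_mem h1, indicator_of_mem h2, betaWeight, rhoWeight]
    have h3 : x ^ (2 * l) = x * (x ^ 2) ^ ((l : ℝ) + 1 / 2 - 1) := by
      rw [← Real.rpow_natCast x 2, ← Real.rpow_mul hx.le, ← Real.rpow_natCast x (2 * l)]
      nth_rewrite 2 [← Real.rpow_one x]
      rw [← Real.rpow_add hx]
      congr 1
      push_cast
      ring
    rw [h3, show (2 : ℝ) - 1 = 1 by norm_num, Real.rpow_one, abs_of_pos two_pos, smul_eq_mul]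
    ring
  · rw [indicator_of_notMem (a := x) fun h' => h h'.2, indicator_of_notMem, smul_zero]
    exact fun h' => h (by nlinarith [h'.2])

theorem integrableOn_pow_mul_rhoWeight_pos (β : ℝ) {e : ℝ} (he : 0 < e) (l : ℕ) :
    IntegrableOn (fun ρ => ρ ^ (2 * l) * rhoWeight e β ρ) (Ioo 0 1) := by
  have h := (integrable_indicator_iff measurableSet_Ioo).2
    (integrableOn_betaWeight_mul β he (by positivity : (0 : ℝ) < l + 1 / 2))
  have h2 := (integrableOn_Ioi_comp_rpow_iff _ two_ne_zero).2 (h.integrableOn (s := Ioi 0))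
  rw [integrableOn_congr_fun (fun x (hx : x ∈ Ioi (0 : ℝ)) => comp_sq_indicator e β l hx)
      measurableSet_Ioi,
    integrableOn_indicator_iff measurableSet_Ioo,
    inter_eq_self_of_subset_left Ioo_subset_Ioi_self] at h2
  exact (integrable_const_mul_iff (isUnit_iff_ne_zero.2 two_ne_zero) _).1 h2

theorem integral_pow_mul_rhoWeight_pos (β : ℝ) {e : ℝ} (he : 0 < e) (l : ℕ) :
    ∫ ρ in Ioo (0 : ℝ) 1, ρ ^ (2 * l) * rhoWeight e β ρ = eulerValue β e (l + 1 / 2) / 2 := by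
  have h := integral_comp_rpow_Ioi ((Ioo (0 : ℝ) 1).indicator
    (fun t => betaWeight (l + 1 / 2) e t * (1 + t) ^ (β / 2))) (two_ne_zero (α := ℝ))
  rw [setIntegral_congr_fun measurableSet_Ioi (fun x (hx : x ∈ Ioi (0 : ℝ)) =>
      comp_sq_indicator e β l hx),
    setIntegral_indicator measurableSet_Ioo, setIntegral_indicator measurableSet_Ioo,
    inter_eq_self_of_subset_right Ioo_subset_Ioi_self,
    integral_betaWeight_mul_eq_eulerValue β he (by positivity), integral_const_mul] at h
  linarith

theorem setIntegral_Ioo_eq_intervalIntegral (f : ℝ → ℝ) :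
    ∫ ρ in Ioo (-1 : ℝ) 1, f ρ = ∫ ρ in (-1 : ℝ)..1, f ρ := by
  rw [intervalIntegral.integral_of_le (by norm_num), integral_Ioc_eq_integral_Ioo]

theorem intervalIntegral_congr_Ioo {f g : ℝ → ℝ} (h : ∀ ρ ∈ Ioo (-1 : ℝ) 1, f ρ = g ρ) :
    ∫ ρ in (-1 : ℝ)..1, f ρ = ∫ ρ in (-1 : ℝ)..1, g ρ := by
  rw [← setIntegral_Ioo_eq_intervalIntegral, ← setIntegral_Ioo_eq_intervalIntegral]
  exact setIntegral_congr_fun measurableSet_Ioo h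

theorem intervalIntegrable_congr_Ioo {f g : ℝ → ℝ} (h : ∀ ρ ∈ Ioo (-1 : ℝ) 1, f ρ = g ρ)
    (hg : IntervalIntegrable g volume (-1) 1) : IntervalIntegrable f volume (-1) 1 := by
  rw [intervalIntegrable_iff_integrableOn_Ioo_of_le (by norm_num)] at hg ⊢
  exact (integrableOn_congr_fun h measurableSet_Ioo).2 hg

theorem integral_eq_zero_of_odd {f : ℝ → ℝ} (hf : ∀ x, f (-x) = -f x) :
    ∫ ρ in (-1 : ℝ)..1, f ρ = 0 := by
  have h := intervalIntegral.integral_comp_neg (a := -1) (b := 1) f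
  simp only [hf, intervalIntegral.integral_neg, neg_neg] at h
  linarith

theorem intervalIntegrable_pow_mul_rhoWeight (β : ℝ) {e : ℝ} (he : 0 < e) (l : ℕ) :
    IntervalIntegrable (fun ρ => ρ ^ (2 * l) * rhoWeight e β ρ) volume (-1) 1 := by
  have h : IntervalIntegrable (fun ρ => ρ ^ (2 * l) * rhoWeight e β ρ) volume 0 1 := by
    rw [intervalIntegrable_iff_integrableOn_Ioo_of_le zero_le_one]
    exact integrableOn_pow_mul_rhoWeight_pos β he l
  have h' := (IntervalIntegrable.iff_comp_neg).1 h
  simp only [rhoWeight_neg, (even_two_mul l).neg_pow, neg_zero] at h'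
  exact h'.symm.trans h

theorem integral_pow_mul_rhoWeight (β : ℝ) {e : ℝ} (he : 0 < e) (l : ℕ) :
    ∫ ρ in (-1 : ℝ)..1, ρ ^ (2 * l) * rhoWeight e β ρ = eulerValue β e (l + 1 / 2) := by
  have h : IntervalIntegrable (fun ρ => ρ ^ (2 * l) * rhoWeight e β ρ) volume 0 1 := by
    rw [intervalIntegrable_iff_integrableOn_Ioo_of_le zero_le_one]
    exact integrableOn_pow_mul_rhoWeight_pos β he l
  have h' := (IntervalIntegrable.iff_comp_neg).1 h
  have hn := intervalIntegral.integral_comp_neg (a := 0) (b := 1)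
    (fun ρ => ρ ^ (2 * l) * rhoWeight e β ρ)
  simp only [rhoWeight_neg, (even_two_mul l).neg_pow, neg_zero] at h' hn
  rw [← intervalIntegral.integral_add_adjacent_intervals h'.symm h, ← hn,
    intervalIntegral.integral_of_le zero_le_one, integral_Ioc_eq_integral_Ioo,
    integral_pow_mul_rhoWeight_pos β he l]
  ring

theorem intervalIntegrable_rhoWeight (β : ℝ) {e : ℝ} (he : 0 < e) :
    IntervalIntegrable (rhoWeight e β) volume (-1) 1 := by
  simpa using intervalIntegrable_pow_mul_rhoWeight β he 0

theorem sq_mul_sq_lt_one {r ρ : ℝ} (hr : |r| < 1) (hρ : ρ ∈ Icc (-1 : ℝ) 1) :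
    |r ^ 2 * ρ ^ 2| < 1 := by
  rw [abs_of_nonneg (by positivity), ← mul_pow, sq_lt_one_iff_abs_lt_one, abs_mul]
  exact (mul_le_of_le_one_right (abs_nonneg r) (abs_le.2 hρ)).trans_lt hr

theorem continuousOn_gauss2F1_sq (a b : ℝ) {c r : ℝ} (hc : 0 < c) (hr : |r| < 1) :
    ContinuousOn (fun ρ => gauss2F1 a b c (r ^ 2 * ρ ^ 2)) (Icc (-1) 1) := fun ρ hρ =>
  ((continuousAt_gauss2F1 a b hc (sq_mul_sq_lt_one hr hρ)).comp
    (f := fun ρ : ℝ => r ^ 2 * ρ ^ 2) (by fun_prop)).continuousWithinAt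

/-- As `|r| < 1`, the argument `r²ρ²` stays inside the unit disc even at `ρ = ±1`. The
hypergeometric factor is thus continuous on the compact interval, and any endpoint singularity is
that of `rhoWeight`, integrable for `e > 0`. -/
theorem intervalIntegrable_mul_gauss2F1_mul_rhoWeight (a b β : ℝ) {c e r : ℝ} (hc : 0 < c)
    (he : 0 < e) (hr : |r| < 1) {g : ℝ → ℝ} (hg : Continuous g) :
    IntervalIntegrable (fun ρ => g ρ * gauss2F1 a b c (r ^ 2 * ρ ^ 2) * rhoWeight e β ρ)
      volume (-1) 1 := by
  refine (intervalIntegrable_rhoWeight β he).continuousOn_mul ?_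
  rw [uIcc_of_le (by norm_num)]
  exact hg.continuousOn.mul (continuousOn_gauss2F1_sq a b hc hr)

/-- Termwise integration of the Gauss series against an even power of `ρ`. -/
theorem hasSum_integral_gauss2F1 (β : ℝ) {a b c e r : ℝ} (ha : 0 < a) (hb : 0 < b) (hc : 0 < c)
    (he : 0 < e) (hr : |r| < 1) (l : ℕ) :
    HasSum (fun m : ℕ => gaussCoeff a b c m * eulerValue β e (l + 1 / 2 + m) * r ^ (2 * m))
      (∫ ρ in (-1 : ℝ)..1, ρ ^ (2 * l) * gauss2F1 a b c (r ^ 2 * ρ ^ 2) * rhoWeight e β ρ) := by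
  have hw := intervalIntegrable_pow_mul_rhoWeight β he l
  have hr2 : |r ^ 2| < 1 := by simpa using sq_mul_sq_lt_one hr (ρ := 1) (by simp)
  have hsum := (hasSum_gauss2F1 a b hc hr2).summable
  rw [← setIntegral_Ioo_eq_intervalIntegral]
  rw [intervalIntegrable_iff_integrableOn_Ioo_of_le (by norm_num)] at hw
  have h := hasSum_integral_of_dominated_convergence (μ := volume.restrict (Ioo (-1 : ℝ) 1))
    (F := fun (m : ℕ) ρ =>
      ρ ^ (2 * l) * rhoWeight e β ρ * (gaussCoeff a b c m * (r ^ 2 * ρ ^ 2) ^ m))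
    (f := fun ρ => ρ ^ (2 * l) * gauss2F1 a b c (r ^ 2 * ρ ^ 2) * rhoWeight e β ρ)
    -- All factors are nonnegative, so replacing `ρ²` by `1` in the Gauss term dominates it; the
    -- bounds sum because the Gauss series converges at `r²`.
    (fun m ρ => ρ ^ (2 * l) * rhoWeight e β ρ * (gaussCoeff a b c m * (r ^ 2) ^ m))
    (fun m => hw.aestronglyMeasurable.mul (by fun_prop))
    (fun m => ae_restrict_of_forall_mem measurableSet_Ioo fun ρ hρ => by
      have h1 := (gaussCoeff_pos ha hb hc m).le
      have h2 := (rhoWeight_pos (e := e) (β := β) hρ).le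
      have h3 : 0 ≤ ρ ^ (2 * l) := (even_two_mul l).pow_nonneg ρ
      have h4 : r ^ 2 * ρ ^ 2 ≤ r ^ 2 :=
        mul_le_of_le_one_right (by positivity) (by linarith [one_sub_sq_pos hρ])
      rw [Real.norm_of_nonneg (by positivity)]
      gcongr)
    (ae_of_all _ fun ρ => hsum.mul_left _)
    (by simp_rw [tsum_mul_left]; exact hw.mul_const _)
    (ae_restrict_of_forall_mem measurableSet_Ioo fun ρ hρ => by
      have := (hasSum_gauss2F1 a b hc (sq_mul_sq_lt_one hr (Ioo_subset_Icc_self hρ))).mul_left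
        (ρ ^ (2 * l) * rhoWeight e β ρ)
      rwa [mul_right_comm] at this)
  convert! h using 2 with m
  have : ∀ ρ, ρ ^ (2 * l) * rhoWeight e β ρ * (gaussCoeff a b c m * (r ^ 2 * ρ ^ 2) ^ m) =
      gaussCoeff a b c m * r ^ (2 * m) * (ρ ^ (2 * (l + m)) * rhoWeight e β ρ) := by
    intro ρ
    rw [mul_pow, ← pow_mul, ← pow_mul, mul_add 2 l m, pow_add]
    ring
  simp_rw [this]
  rw [integral_const_mul, setIntegral_Ioo_eq_intervalIntegral,
    integral_pow_mul_rhoWeight β he (l + m)]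
  push_cast
  rw [show (l : ℝ) + m + 1 / 2 = l + 1 / 2 + m by ring]
  ring

/-! ### Hypergeometric sequences -/

theorem poch_add (x : ℝ) (i k : ℕ) : poch x (i + k) = poch x i * poch (x + i) k := by
  induction k with
  | zero => simp [poch_zero]
  | succ k ih => rw [← add_assoc, poch_succ, poch_succ, ih]; push_cast; ring

/-- Here `(1 + t)^j` is a polynomial, so the Euler integral is a finite sum of shifted Beta values;
`(b+e)_j` is their common denominator relative to `B(b, e)`. -/
theorem eulerValue_two_mul_natCast {e b : ℝ} (he : 0 < e) (hb : 0 < b) (j : ℕ) :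
    poch (b + e) j * eulerValue (2 * j) e b =
      (∑ i ∈ Finset.range (j + 1), (j.choose i : ℝ) * poch b i * poch (b + e + i) (j - i)) *
        ProbabilityTheory.beta b e := by
  have h1 : eulerValue (2 * j) e b =
      ∑ i ∈ Finset.range (j + 1), (j.choose i : ℝ) * ProbabilityTheory.beta (b + i) e := by
    rw [← integral_betaWeight_mul_eq_eulerValue _ he hb]
    have : ∀ t ∈ Ioo (0 : ℝ) 1, betaWeight b e t * (1 + t) ^ ((2 * j : ℝ) / 2) =
        ∑ i ∈ Finset.range (j + 1), (j.choose i : ℝ) * betaWeight (b + i) e t := by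
      intro t ht
      rw [mul_div_cancel_left₀ _ two_ne_zero, Real.rpow_natCast, add_comm, add_pow,
        Finset.mul_sum]
      refine Finset.sum_congr rfl fun i _ => ?_
      rw [← betaWeight_mul_pow ht.1, one_pow]
      ring
    rw [setIntegral_congr_fun measurableSet_Ioo this, integral_finsetSum]
    · refine Finset.sum_congr rfl fun i _ => ?_
      rw [integral_const_mul, integral_betaWeight (by positivity) he]
    · exact fun i _ => (integrableOn_betaWeight (by positivity) he).const_mul _
  rw [h1, Finset.mul_sum, Finset.sum_mul]
  refine Finset.sum_congr rfl fun i hi => ?_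
  have hij : i + (j - i) = j := by have := Finset.mem_range.1 hi; omega
  have h2 := poch_add (b + e) i (j - i)
  rw [hij] at h2
  rw [beta_add_natCast hb he, h2]
  have := (poch_pos (by positivity : 0 < b + e) i).ne'
  field_simp

theorem isHypergeometricSeq_gaussCoeff_mul_eulerValue (a b : ℝ) {c e x : ℝ} (hc : 0 < c)
    (he : 0 < e) (hx : 0 < x) (j : ℕ) :
    IsHypergeometricSeq fun m => gaussCoeff a b c m * eulerValue (2 * j) e (x + m) := by
  classical
  let shift : ℝ → Polynomial ℝ := fun v => Polynomial.X + Polynomial.C v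
  let N : Polynomial ℝ := ∑ i ∈ Finset.range (j + 1), Polynomial.C (j.choose i : ℝ) *
    (ascPochhammer ℝ i).comp (shift x) * (ascPochhammer ℝ (j - i)).comp (shift (x + e + i))
  let D : Polynomial ℝ := (ascPochhammer ℝ j).comp (shift (x + e))
  have hN : ∀ m : ℕ, N.eval (m : ℝ) = ∑ i ∈ Finset.range (j + 1),
      (j.choose i : ℝ) * poch (x + m) i * poch (x + m + e + i) (j - i) := by
    intro m
    simp only [N, shift, Polynomial.eval_finsetSum, Polynomial.eval_mul, Polynomial.eval_C,
      Polynomial.eval_comp, Polynomial.eval_add, Polynomial.eval_X, poch]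
    refine Finset.sum_congr rfl fun i _ => ?_
    rw [add_comm (m : ℝ) x, show (m : ℝ) + (x + e + i) = x + m + e + i by ring]
  have hD : ∀ m : ℕ, D.eval (m : ℝ) = poch (x + m + e) j := by
    intro m
    simp only [D, shift, Polynomial.eval_comp, Polynomial.eval_add, Polynomial.eval_C,
      Polynomial.eval_X, poch]
    rw [show (m : ℝ) + (x + e) = x + m + e by ring]
  have hV : ∀ m : ℕ, D.eval (m : ℝ) * eulerValue (2 * j) e (x + m) =
      N.eval (m : ℝ) * ProbabilityTheory.beta (x + m) e := fun m => by
    rw [hN, hD, eulerValue_two_mul_natCast he (by positivity)]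
  -- The ratio of consecutive terms has `N(m)` in its denominator, so it must not vanish at natural
  -- numbers.
  have hNpos : ∀ m : ℕ, 0 < N.eval (m : ℝ) := fun m => by
    rw [hN]
    refine Finset.sum_pos (fun i hi => ?_) (by simp)
    have h1 : 0 < j.choose i := Nat.choose_pos (by have := Finset.mem_range.1 hi; omega)
    have h2 := poch_pos (by positivity : 0 < x + m) i
    have h3 := poch_pos (by positivity : 0 < x + m + e + i) (j - i)
    positivity
  have hDpos : ∀ m : ℕ, 0 < D.eval (m : ℝ) := fun m => by
    rw [hD]; exact poch_pos (by positivity) j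
  have hβ : ∀ m : ℕ, (x + m + e) * ProbabilityTheory.beta (x + (m + 1 : ℕ)) e =
      (x + m) * ProbabilityTheory.beta (x + m) e := fun m => by
    have h := beta_add_natCast (by positivity : 0 < x + m) he 1
    simp only [poch_succ, poch_zero, Nat.cast_zero, add_zero, one_mul, Nat.cast_one] at h
    rw [Nat.cast_succ, ← add_assoc, h]
    have : x + m + e ≠ 0 := by positivity
    field_simp
  have hg : ∀ m : ℕ, (c + m) * (m + 1) * gaussCoeff a b c (m + 1) =
      (a + m) * (b + m) * gaussCoeff a b c m := fun m => by
    simp only [gaussCoeff, poch_succ, Nat.factorial_succ]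
    have h1 := (poch_pos hc m).ne'
    have h2 : c + m ≠ 0 := by positivity
    push_cast
    field_simp
  -- By `hV` the Euler value is the Beta value times `N/D`. The ratio is the product of the Gauss
  -- ratio `(a+m)(b+m)/((c+m)(m+1))`, the Beta ratio `(x+m)/(x+e+m)` and `N(m+1)D(m)/(N(m)D(m+1))`.
  refine ⟨shift a * shift b * shift x * N.comp (shift 1) * D,
    shift c * shift 1 * shift (x + e) * D.comp (shift 1) * N, fun m => ?_⟩
  have h1 := hV (m + 1)
  have h2 := hNpos m
  have h3 := hDpos (m + 1)
  simp only [Polynomial.eval_mul, Polynomial.eval_comp, shift, Polynomial.eval_add,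
    Polynomial.eval_X, Polynomial.eval_C]
  rw [Nat.cast_succ] at h1 h3
  refine ⟨by positivity, ?_⟩
  have h4 := hβ m
  rw [Nat.cast_succ] at h4 ⊢
  calc _ = ((c + m) * (m + 1) * gaussCoeff a b c (m + 1)) * (x + m + e) * N.eval (m : ℝ) *
        (D.eval ((m : ℝ) + 1) * eulerValue (2 * j) e (x + (m + 1))) := by ring
    _ = (a + m) * (b + m) * gaussCoeff a b c m * N.eval (m : ℝ) * N.eval ((m : ℝ) + 1) *
        ((x + m + e) * ProbabilityTheory.beta (x + (m + 1)) e) := by rw [hg, h1]; ring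
    _ = (a + m) * (b + m) * (x + m) * gaussCoeff a b c m * N.eval ((m : ℝ) + 1) *
        (N.eval (m : ℝ) * ProbabilityTheory.beta (x + m) e) := by rw [h4]; ring
    _ = _ := by rw [← hV]; ring

/-! ### The integral over the scale parameters -/

/-- This and its odd companion are where the third parameters `1/2` and `3/2` of the two Gauss
series come from. -/
theorem factorial_two_mul (m : ℕ) :
    ((2 * m).factorial : ℝ) = 4 ^ m * (poch (1 / 2) m * m.factorial) := by
  induction m with
  | zero => simp [poch_zero]
  | succ m ih =>
    rw [show 2 * (m + 1) = 2 * m + 1 + 1 by ring, Nat.factorial_succ, Nat.factorial_succ,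
      Nat.factorial_succ, poch_succ]
    push_cast
    rw [ih]
    ring

theorem factorial_two_mul_add_one (m : ℕ) :
    ((2 * m + 1).factorial : ℝ) = 4 ^ m * (poch (3 / 2) m * m.factorial) := by
  induction m with
  | zero => simp [poch_zero]
  | succ m ih =>
    rw [show 2 * (m + 1) + 1 = 2 * m + 1 + 1 + 1 by ring, Nat.factorial_succ,
      Nat.factorial_succ (2 * m + 1), Nat.factorial_succ m, poch_succ]
    push_cast
    rw [ih]
    ring

/-- `∑ (2c)^j / j! Γ(a + j/2) Γ(b + j/2)`, split into even and odd terms. -/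
noncomputable def gammaSeries (a b c : ℝ) : ℝ :=
  Real.Gamma a * Real.Gamma b * gauss2F1 a b (1 / 2) (c ^ 2) +
    2 * c * (Real.Gamma (a + 1 / 2) * Real.Gamma (b + 1 / 2)) *
      gauss2F1 (a + 1 / 2) (b + 1 / 2) (3 / 2) (c ^ 2)

/-- At `j = 2m` the Gamma arguments shift by the integer `m`, at `j = 2m + 1` by `m` after a half
step, so each parity class is a Gauss series in `c²`. -/
theorem hasSum_gammaSeries {a b c : ℝ} (ha : 0 < a) (hb : 0 < b) (hc : |c| < 1) :
    HasSum (fun j : ℕ => (2 * c) ^ j / j.factorial *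
      (Real.Gamma (a + j / 2) * Real.Gamma (b + j / 2))) (gammaSeries a b c) := by
  have hc2 : |c ^ 2| < 1 := by rw [abs_pow]; exact pow_lt_one₀ (abs_nonneg c) hc two_ne_zero
  refine HasSum.even_add_odd ?_ ?_
  · convert! (hasSum_gauss2F1 a b (by norm_num : (0 : ℝ) < 1 / 2) hc2).mul_left
      (Real.Gamma a * Real.Gamma b) using 2 with m
    have h1 : ((2 * m : ℕ) : ℝ) / 2 = m := by push_cast; ring
    rw [h1, Gamma_add_natCast ha, Gamma_add_natCast hb, factorial_two_mul, gaussCoeff, pow_mul,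
      mul_pow, mul_pow]
    have := (poch_pos (by norm_num : (0 : ℝ) < 1 / 2) m).ne'
    rw [show (2 : ℝ) ^ 2 = 4 by norm_num]
    field_simp
  · convert! (hasSum_gauss2F1 (a + 1 / 2) (b + 1 / 2) (by norm_num : (0 : ℝ) < 3 / 2) hc2).mul_left
      (2 * c * (Real.Gamma (a + 1 / 2) * Real.Gamma (b + 1 / 2))) using 2 with m
    have h1 : ∀ u : ℝ, u + ((2 * m + 1 : ℕ) : ℝ) / 2 = u + 1 / 2 + m := by
      intro u; push_cast; ring
    rw [h1, h1, Gamma_add_natCast (by positivity), Gamma_add_natCast (by positivity),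
      factorial_two_mul_add_one, gaussCoeff, pow_succ, pow_mul, mul_pow, mul_pow]
    have := (poch_pos (by norm_num : (0 : ℝ) < 3 / 2) m).ne'
    rw [show (2 : ℝ) ^ 2 = 4 by norm_num]
    field_simp

theorem gammaSeries_pos {a b c : ℝ} (ha : 0 < a) (hb : 0 < b) (hc : 0 ≤ c) (hc1 : c < 1) :
    0 < gammaSeries a b c := by
  have h2 : c ^ 2 < 1 := by nlinarith
  have h3 := one_le_gauss2F1 ha hb (by norm_num : (0 : ℝ) < 1 / 2) (sq_nonneg c) h2
  have h4 := one_le_gauss2F1 (by positivity : 0 < a + 1 / 2) (by positivity : 0 < b + 1 / 2)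
    (by norm_num : (0 : ℝ) < 3 / 2) (sq_nonneg c) h2
  have := Real.Gamma_pos_of_pos ha
  have := Real.Gamma_pos_of_pos hb
  have := Real.Gamma_pos_of_pos (by positivity : 0 < a + 1 / 2)
  have := Real.Gamma_pos_of_pos (by positivity : 0 < b + 1 / 2)
  unfold gammaSeries
  positivity

/-- The kernel `σ^(-2p-1) exp(-q/σ²)`. -/
noncomputable def scaleKernel (p q σ : ℝ) : ℝ := σ ^ (-2 * p - 1) * Real.exp (-(q / σ ^ 2))

/-- The substitution `t = σ^(-2)` turns this into a Gamma integral. -/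
theorem integral_scaleKernel {p q : ℝ} (hp : 0 < p) (hq : 0 < q) :
    ∫ σ in Ioi (0 : ℝ), scaleKernel p q σ = 1 / 2 * (q ^ (-p) * Real.Gamma p) := by
  have h := integral_comp_rpow_Ioi (fun t : ℝ => t ^ (p - 1) * Real.exp (-(q * t)))
    (by norm_num : (-2 : ℝ) ≠ 0)
  rw [Real.integral_rpow_mul_exp_neg_mul_Ioi hp hq] at h
  have h2 : ∀ σ ∈ Ioi (0 : ℝ), (|(-2 : ℝ)| * σ ^ ((-2 : ℝ) - 1)) •
      ((σ ^ (-2 : ℝ)) ^ (p - 1) * Real.exp (-(q * σ ^ (-2 : ℝ)))) = 2 * scaleKernel p q σ := by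
    intro σ hσ
    have hσ' : 0 < σ := hσ
    rw [smul_eq_mul, scaleKernel, ← Real.rpow_mul hσ'.le, abs_neg, abs_two]
    have h3 : σ ^ (-2 * p - 1) = σ ^ ((-2 : ℝ) - 1) * σ ^ (-2 * (p - 1)) := by
      rw [← Real.rpow_add hσ']; congr 1; ring
    rw [h3, Real.rpow_neg hσ'.le, Real.rpow_two, div_eq_mul_inv]
    ring
  rw [setIntegral_congr_fun measurableSet_Ioi h2, integral_const_mul, one_div q,
    Real.inv_rpow hq.le, ← Real.rpow_neg hq.le] at h
  linarith

theorem integrableOn_scaleKernel {p q : ℝ} (hp : 0 < p) (hq : 0 < q) :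
    IntegrableOn (scaleKernel p q) (Ioi 0) :=
  .of_integral_ne_zero (by
    rw [integral_scaleKernel hp hq]
    have := Real.Gamma_pos_of_pos hp
    positivity)

theorem scaleKernel_nonneg {p q σ : ℝ} (hσ : 0 < σ) : 0 ≤ scaleKernel p q σ := by
  unfold scaleKernel; positivity

theorem scaleKernel_add_half {p q σ : ℝ} (hσ : 0 < σ) (j : ℕ) :
    scaleKernel (p + j / 2) q σ = scaleKernel p q σ * (σ⁻¹) ^ j := by
  have : -2 * (p + j / 2) - 1 = (-2 * p - 1) + -(j : ℝ) := by ring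
  rw [scaleKernel, scaleKernel, this, Real.rpow_add hσ, Real.rpow_neg hσ.le, Real.rpow_natCast,
    inv_pow]
  ring

/-- The integrand over the scale parameters. -/
noncomputable def scaleIntegrand (a b κ s1 s2 c : ℝ) (σ : ℝ × ℝ) : ℝ :=
  σ.1 ^ (-2 * a - 1) * σ.2 ^ (-2 * b - 1) *
    Real.exp (-κ * ((s1 / σ.1) ^ 2 - 2 * c * (s1 * s2 / (σ.1 * σ.2)) + (s2 / σ.2) ^ 2))

theorem scaleIntegrand_eq (a b κ s1 s2 c : ℝ) (σ : ℝ × ℝ) :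
    scaleIntegrand a b κ s1 s2 c σ =
      scaleKernel a (κ * s1 ^ 2) σ.1 * scaleKernel b (κ * s2 ^ 2) σ.2 *
        Real.exp (2 * κ * c * s1 * s2 * (σ.1⁻¹ * σ.2⁻¹)) := by
  have : -κ * ((s1 / σ.1) ^ 2 - 2 * c * (s1 * s2 / (σ.1 * σ.2)) + (s2 / σ.2) ^ 2) =
      -(κ * s1 ^ 2 / σ.1 ^ 2) + -(κ * s2 ^ 2 / σ.2 ^ 2) +
        2 * κ * c * s1 * s2 * (σ.1⁻¹ * σ.2⁻¹) := by
    simp only [div_eq_mul_inv, mul_pow, mul_inv, inv_pow]; ring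
  rw [scaleIntegrand, this, Real.exp_add, Real.exp_add, scaleKernel, scaleKernel]
  ring

theorem scaleIntegrand_nonneg {a b κ s1 s2 c : ℝ} {σ : ℝ × ℝ}
    (hσ : σ ∈ Ioi (0 : ℝ) ×ˢ Ioi (0 : ℝ)) : 0 ≤ scaleIntegrand a b κ s1 s2 c σ := by
  have h1 : 0 < σ.1 := hσ.1
  have h2 : 0 < σ.2 := hσ.2
  unfold scaleIntegrand; positivity

/-- The powers of `κ`, `s1`, `s2` produced by the `j`-th term cancel those in the expanded
exponential; only `c` remains in the series. -/
theorem rpow_mul_sq_mul {κ s1 s2 : ℝ} (a b : ℝ) (hκ : 0 < κ) (hs1 : 0 < s1) (hs2 : 0 < s2)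
    (j : ℕ) : (κ * s1 ^ 2) ^ (-(a + j / 2)) * (κ * s2 ^ 2) ^ (-(b + j / 2)) * (κ * s1 * s2) ^ j =
      (κ * s1 ^ 2) ^ (-a) * (κ * s2 ^ 2) ^ (-b) := by
  rw [neg_add, neg_add, Real.rpow_add (by positivity), Real.rpow_add (by positivity)]
  have h : (κ * s1 ^ 2) ^ (-((j : ℝ) / 2)) * (κ * s2 ^ 2) ^ (-((j : ℝ) / 2)) *
      (κ * s1 * s2) ^ j = 1 := by
    rw [← Real.mul_rpow (by positivity) (by positivity),
      show κ * s1 ^ 2 * (κ * s2 ^ 2) = (κ * s1 * s2) ^ (2 : ℝ) by rw [Real.rpow_two]; ring,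
      ← Real.rpow_mul (by positivity), ← Real.rpow_natCast (κ * s1 * s2) j,
      ← Real.rpow_add (by positivity)]
    rw [show 2 * -((j : ℝ) / 2) + j = 0 by ring, Real.rpow_zero]
  calc _ = (κ * s1 ^ 2) ^ (-a) * (κ * s2 ^ 2) ^ (-b) * ((κ * s1 ^ 2) ^ (-((j : ℝ) / 2)) *
        (κ * s2 ^ 2) ^ (-((j : ℝ) / 2)) * (κ * s1 * s2) ^ j) := by ring
    _ = _ := by rw [h, mul_one]

/-- Expand the coupling exponential; each power of `1/(σ1 σ2)` raises both kernel parameters by a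
half, and the terms separate. -/
theorem integral_scaleIntegrand {a b κ s1 s2 c : ℝ} (ha : 0 < a) (hb : 0 < b) (hκ : 0 < κ)
    (hs1 : 0 < s1) (hs2 : 0 < s2) (hc : |c| < 1) :
    ∫ σ in Ioi (0 : ℝ) ×ˢ Ioi (0 : ℝ), scaleIntegrand a b κ s1 s2 c σ =
      1 / 4 * ((κ * s1 ^ 2) ^ (-a) * (κ * s2 ^ 2) ^ (-b)) * gammaSeries a b c := by
  set M : ℝ := 1 / 4 * ((κ * s1 ^ 2) ^ (-a) * (κ * s2 ^ 2) ^ (-b)) with hM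
  let F : ℝ → ℕ → ℝ × ℝ → ℝ := fun c j σ => (2 * κ * c * s1 * s2) ^ j / j.factorial *
    (scaleKernel (a + j / 2) (κ * s1 ^ 2) σ.1 * scaleKernel (b + j / 2) (κ * s2 ^ 2) σ.2)
  have hint : ∀ c j, IntegrableOn (F c j) (Ioi (0 : ℝ) ×ˢ Ioi (0 : ℝ)) := by
    intro c j
    rw [IntegrableOn, Measure.volume_eq_prod, ← Measure.prod_restrict]
    exact ((integrableOn_scaleKernel (by positivity) (by positivity)).mul_prod
      (integrableOn_scaleKernel (by positivity) (by positivity))).const_mul _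
  have hval : ∀ c j, ∫ σ in Ioi (0 : ℝ) ×ˢ Ioi (0 : ℝ), F c j σ =
      M * ((2 * c) ^ j / j.factorial *
        (Real.Gamma (a + j / 2) * Real.Gamma (b + j / 2))) := by
    intro c j
    simp only [F]
    rw [integral_const_mul, Measure.volume_eq_prod, setIntegral_prod_mul,
      integral_scaleKernel (by positivity) (by positivity),
      integral_scaleKernel (by positivity) (by positivity), hM,
      ← rpow_mul_sq_mul a b hκ hs1 hs2 j,
      show 2 * κ * c * s1 * s2 = 2 * c * (κ * s1 * s2) by ring, mul_pow]
    ring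
  have hS : MeasurableSet (Ioi (0 : ℝ) ×ˢ Ioi (0 : ℝ)) := measurableSet_Ioi.prod measurableSet_Ioi
  -- The norm of a term is the same term at `|c|`, so the series of norms is again a convergent
  -- Gamma series and the interchange is legitimate.
  have hnorm : ∀ j, ∫ σ in Ioi (0 : ℝ) ×ˢ Ioi (0 : ℝ), ‖F c j σ‖ =
      ∫ σ in Ioi (0 : ℝ) ×ˢ Ioi (0 : ℝ), F |c| j σ := by
    intro j
    refine setIntegral_congr_fun hS fun σ hσ => ?_
    have h1 := scaleKernel_nonneg (p := a + j / 2) (q := κ * s1 ^ 2) hσ.1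
    have h2 := scaleKernel_nonneg (p := b + j / 2) (q := κ * s2 ^ 2) hσ.2
    simp only [F, norm_mul, norm_div, norm_pow, Real.norm_eq_abs]
    rw [abs_of_nonneg h1, abs_of_nonneg h2, abs_of_pos hκ, abs_of_pos hs1, abs_of_pos hs2,
      abs_of_pos two_pos, Nat.abs_cast]
  have h := hasSum_integral_of_summable_integral_norm
    (μ := volume.restrict (Ioi (0 : ℝ) ×ˢ Ioi (0 : ℝ))) (F := F c) (hint c) (by
      simp_rw [hnorm, hval]
      exact ((hasSum_gammaSeries ha hb (by rwa [abs_abs])).summable).mul_left _)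
  simp_rw [hval] at h
  rw [← h.unique ((hasSum_gammaSeries ha hb hc).mul_left M)]
  refine setIntegral_congr_fun hS fun σ hσ => ?_
  have hexp : HasSum (fun j : ℕ => (2 * κ * c * s1 * s2 * (σ.1⁻¹ * σ.2⁻¹)) ^ j / j.factorial)
      (Real.exp (2 * κ * c * s1 * s2 * (σ.1⁻¹ * σ.2⁻¹))) := by
    rw [Real.exp_eq_exp_ℝ]
    exact NormedSpace.expSeries_div_hasSum_exp _
  have h2 := hexp.mul_left (scaleKernel a (κ * s1 ^ 2) σ.1 * scaleKernel b (κ * s2 ^ 2) σ.2)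
  rw [← scaleIntegrand_eq] at h2
  rw [← h2.tsum_eq]
  refine tsum_congr fun j => ?_
  simp only [F]
  rw [scaleKernel_add_half hσ.1, scaleKernel_add_half hσ.2, mul_pow (2 * κ * c * s1 * s2),
    mul_pow]
  ring

/-- At `|c|` the integral is positive, hence the integrand is integrable there; it dominates the
integrand at `c`. -/
theorem integrableOn_scaleIntegrand {a b κ s1 s2 c : ℝ} (ha : 0 < a) (hb : 0 < b) (hκ : 0 < κ)
    (hs1 : 0 < s1) (hs2 : 0 < s2) (hc : |c| < 1) :
    IntegrableOn (scaleIntegrand a b κ s1 s2 c) (Ioi (0 : ℝ) ×ˢ Ioi (0 : ℝ)) := by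
  have h : IntegrableOn (scaleIntegrand a b κ s1 s2 |c|) (Ioi (0 : ℝ) ×ˢ Ioi (0 : ℝ)) :=
    .of_integral_ne_zero (by
      rw [integral_scaleIntegrand ha hb hκ hs1 hs2 (by rwa [abs_abs])]
      have := gammaSeries_pos ha hb (abs_nonneg c) hc
      positivity)
  refine Integrable.mono' h
    (Measurable.aestronglyMeasurable (by unfold scaleIntegrand; fun_prop)) ?_
  refine ae_restrict_of_forall_mem (measurableSet_Ioi.prod measurableSet_Ioi) fun σ hσ => ?_
  rw [Real.norm_of_nonneg (scaleIntegrand_nonneg hσ), scaleIntegrand_eq, scaleIntegrand_eq]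
  have h1 := scaleKernel_nonneg (p := a) (q := κ * s1 ^ 2) hσ.1
  have h2 := scaleKernel_nonneg (p := b) (q := κ * s2 ^ 2) hσ.2
  have h3 : 0 < σ.1 := hσ.1
  have h4 : 0 < σ.2 := hσ.2
  gcongr
  exact le_abs_self c

/-! ### The integral over the means -/

theorem lintegral_gaussian {A b : ℝ} (hA : 0 ≤ A) (hb : 0 < b) (d : ℝ) :
    ∫⁻ x, ENNReal.ofReal (A * Real.exp (-b * (x - d) ^ 2)) =
      ENNReal.ofReal (A * √(Real.pi / b)) := by
  rw [← ofReal_integral_eq_lintegral_ofReal]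
  · rw [integral_const_mul, integral_sub_right_eq_self (fun x => Real.exp (-b * x ^ 2)) d,
      integral_gaussian]
  · exact ((integrable_exp_neg_mul_sq hb).comp_sub_right d).const_mul A
  · exact ae_of_all _ fun x => by positivity

theorem lintegral_bivariate_gaussian {A κ σ1 σ2 ρ : ℝ} (hA : 0 ≤ A) (hκ : 0 < κ) (hσ1 : 0 < σ1)
    (hσ2 : 0 < σ2) (hρ : 0 < 1 - ρ ^ 2) (x1 x2 : ℝ) :
    ∫⁻ μ2, ∫⁻ μ1, ENNReal.ofReal (A * Real.exp (-κ * ((x1 - μ1) ^ 2 / σ1 ^ 2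
        - 2 * ρ * ((x1 - μ1) * (x2 - μ2) / (σ1 * σ2)) + (x2 - μ2) ^ 2 / σ2 ^ 2))) =
      ENNReal.ofReal (A * (Real.pi * σ1 * σ2 / (κ * √(1 - ρ ^ 2)))) := by
  have h1 : ∀ μ2, ∫⁻ μ1, ENNReal.ofReal (A * Real.exp (-κ * ((x1 - μ1) ^ 2 / σ1 ^ 2
        - 2 * ρ * ((x1 - μ1) * (x2 - μ2) / (σ1 * σ2)) + (x2 - μ2) ^ 2 / σ2 ^ 2))) =
      ENNReal.ofReal (A * √(Real.pi / (κ / σ1 ^ 2)) *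
        Real.exp (-(κ * (1 - ρ ^ 2) / σ2 ^ 2) * (μ2 - x2) ^ 2)) := by
    intro μ2
    -- Completing the square in `μ1` for fixed `μ2`: the centre is the regression value, and a
    -- Gaussian in `μ2` with precision factor `1 - ρ²` is left over.
    have h := lintegral_gaussian
      (A := A * Real.exp (-(κ * (1 - ρ ^ 2) / σ2 ^ 2) * (μ2 - x2) ^ 2))
      (by positivity) (by positivity : 0 < κ / σ1 ^ 2) (x1 - ρ * σ1 * (x2 - μ2) / σ2)
    rw [mul_right_comm A, ← h]
    refine lintegral_congr fun μ1 => ?_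
    rw [mul_assoc A, ← Real.exp_add]
    congr 3
    field_simp
    ring
  simp_rw [h1]
  rw [lintegral_gaussian (by positivity) (by positivity)]
  congr 1
  rw [mul_assoc, ← Real.sqrt_mul (by positivity)]
  congr 1
  have : Real.pi / (κ / σ1 ^ 2) * (Real.pi / (κ * (1 - ρ ^ 2) / σ2 ^ 2)) =
      (Real.pi * σ1 * σ2 / κ) ^ 2 / (1 - ρ ^ 2) := by
    field_simp
  rw [this, Real.sqrt_div (by positivity), Real.sqrt_sq (by positivity)]
  field_simp

/-! ### Integrating out the nuisance parameters -/

/-- The closed form of `p_{γ,δ}(y₀)`. -/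
noncomputable def nullConst (y : Summary) (γ δ : ℝ) : ℝ :=
  2 ^ ((-γ - δ - 4) / 2) * (Real.pi ^ (1 - (y.n : ℝ)) / y.n) *
    (y.n * y.s1 ^ 2) ^ ((1 + γ - y.n) / 2) * (y.n * y.s2 ^ 2) ^ ((1 + δ - y.n) / 2) *
    Real.Gamma ((y.n - γ - 1) / 2) * Real.Gamma ((y.n - δ - 1) / 2)

theorem measurable_likelihood (y : Summary) :
    Measurable fun θ : Nuisance × ℝ => likelihood y θ.1 θ.2 := by
  unfold likelihood
  fun_prop

theorem measurable_priorNuisance (γ δ : ℝ) : Measurable (priorNuisance γ δ) := by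
  unfold priorNuisance
  fun_prop

theorem likelihood_mul_priorNuisance_nonneg (y : Summary) (γ δ ρ : ℝ) {θ₀ : Nuisance}
    (h : θ₀ ∈ nuisanceSet) : 0 ≤ likelihood y θ₀ ρ * priorNuisance γ δ θ₀ := by
  obtain ⟨μ1, μ2, σ1, σ2⟩ := θ₀
  have h1 : 0 < σ1 := h.2.2.1
  have h2 : 0 < σ2 := h.2.2.2
  simp only [likelihood, priorNuisance]
  positivity

theorem volume_restrict_nuisanceSet :
    (volume : Measure Nuisance).restrict nuisanceSet =
      (volume : Measure ℝ).prod ((volume : Measure ℝ).prod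
        ((volume : Measure (ℝ × ℝ)).restrict (Ioi 0 ×ˢ Ioi 0))) := by
  rw [nuisanceSet, Measure.volume_eq_prod, ← Measure.prod_restrict, Measure.restrict_univ,
    Measure.volume_eq_prod, ← Measure.prod_restrict, Measure.restrict_univ]

/-- The likelihood, the prior and the integral over the means contribute `σ1^(-n)`, `σ1^(γ-1)` and
`σ1`, likewise for `σ2` with `δ`. This fixes the kernel parameters `(n-γ-1)/2` and `(n-δ-1)/2`; `E`
stands for the exponential free of the means. -/
theorem scale_prefactor (y : Summary) {γ δ σ1 σ2 ρ : ℝ} (hn : 0 < y.n) (hσ1 : 0 < σ1)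
    (hσ2 : 0 < σ2) (hρ : 0 < 1 - ρ ^ 2) (E : ℝ) :
    ((2 * Real.pi * σ1 * σ2 * √(1 - ρ ^ 2)) ^ y.n)⁻¹ * E * (σ1 ^ (γ - 1) * σ2 ^ (δ - 1)) *
        (Real.pi * σ1 * σ2 / (y.n / (2 * (1 - ρ ^ 2)) * √(1 - ρ ^ 2))) =
      (2 * Real.pi * √(1 - ρ ^ 2)) ^ (1 - (y.n : ℝ)) / y.n *
        (σ1 ^ (-2 * ((y.n - γ - 1) / 2) - 1) * σ2 ^ (-2 * ((y.n - δ - 1) / 2) - 1) * E) := by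
  have hn' : (0 : ℝ) < y.n := by exact_mod_cast hn
  have hs : 0 < √(1 - ρ ^ 2) := Real.sqrt_pos.2 hρ
  have hss : √(1 - ρ ^ 2) * √(1 - ρ ^ 2) = 1 - ρ ^ 2 := Real.mul_self_sqrt hρ.le
  set s := √(1 - ρ ^ 2)
  rw [← hss]
  have e1 : σ1 ^ (-2 * ((y.n - γ - 1) / 2) - 1) = σ1 ^ (γ - 1) * σ1 / σ1 ^ y.n := by
    rw [show -2 * ((y.n - γ - 1) / 2) - 1 = (γ - 1) + 1 - (y.n : ℝ) by ring, Real.rpow_sub hσ1,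
      Real.rpow_add hσ1, Real.rpow_one, Real.rpow_natCast]
  have e2 : σ2 ^ (-2 * ((y.n - δ - 1) / 2) - 1) = σ2 ^ (δ - 1) * σ2 / σ2 ^ y.n := by
    rw [show -2 * ((y.n - δ - 1) / 2) - 1 = (δ - 1) + 1 - (y.n : ℝ) by ring, Real.rpow_sub hσ2,
      Real.rpow_add hσ2, Real.rpow_one, Real.rpow_natCast]
  rw [e1, e2, Real.rpow_sub (x := 2 * Real.pi * s) (by positivity), Real.rpow_one,
    Real.rpow_natCast]
  simp only [mul_pow]
  field_simp

/-- The powers of `1 - ρ²` from the prefactor and the two scale integrals combine to the exponent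
`(n-γ-δ-1)/2` of `A` and `B`; what does not depend on `ρ` is `nullConst`. -/
theorem const_mul_reducedLikelihood (y : Summary) {γ δ ρ : ℝ} (hn : 0 < y.n) (hs1 : 0 < y.s1)
    (hs2 : 0 < y.s2) (hγ : γ + 1 < (y.n : ℝ)) (hδ : δ + 1 < (y.n : ℝ)) (hρ : 0 < 1 - ρ ^ 2) :
    (2 * Real.pi * √(1 - ρ ^ 2)) ^ (1 - (y.n : ℝ)) / y.n *
      (1 / 4 * ((y.n / (2 * (1 - ρ ^ 2)) * y.s1 ^ 2) ^ (-((y.n - γ - 1) / 2)) *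
        (y.n / (2 * (1 - ρ ^ 2)) * y.s2 ^ 2) ^ (-((y.n - δ - 1) / 2))) *
        gammaSeries ((y.n - γ - 1) / 2) ((y.n - δ - 1) / 2) (y.r * ρ)) =
      nullConst y γ δ * reducedLikelihood y.n y.r γ δ ρ := by
  have hn' : (0 : ℝ) < y.n := by exact_mod_cast hn
  have hga := Real.Gamma_pos_of_pos (by linarith : 0 < (y.n - γ - 1) / 2)
  have hgb := Real.Gamma_pos_of_pos (by linarith : 0 < (y.n - δ - 1) / 2)
  have hG : gammaSeries ((y.n - γ - 1) / 2) ((y.n - δ - 1) / 2) (y.r * ρ) *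
      (1 - ρ ^ 2) ^ ((y.n - γ - δ - 1) / 2) =
      Real.Gamma ((y.n - γ - 1) / 2) * Real.Gamma ((y.n - δ - 1) / 2) *
        reducedLikelihood y.n y.r γ δ ρ := by
    rw [reducedLikelihood, partA, partB, gammaSeries, ratioW,
      show (y.n - γ - 1) / 2 + 1 / 2 = (y.n - γ) / 2 by ring,
      show (y.n - δ - 1) / 2 + 1 / 2 = (y.n - δ) / 2 by ring, mul_pow]
    field_simp
  have hs : ∀ s u : ℝ, 0 < s → (y.n / (2 * (1 - ρ ^ 2)) * s ^ 2) ^ (-u) =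
      (y.n * s ^ 2) ^ (-u) * (2 ^ u * (1 - ρ ^ 2) ^ u) := by
    intro s u hs
    rw [show y.n / (2 * (1 - ρ ^ 2)) * s ^ 2 = y.n * s ^ 2 * (2 * (1 - ρ ^ 2))⁻¹ by
      field_simp, Real.mul_rpow (by positivity) (by positivity),
      Real.inv_rpow (by positivity), ← Real.rpow_neg (by positivity), neg_neg,
      Real.mul_rpow (by positivity) hρ.le]
  have h2 : (2 : ℝ) ^ (1 - (y.n : ℝ)) * (1 / 4) * (2 ^ ((y.n - γ - 1) / 2) *
      2 ^ ((y.n - δ - 1) / 2)) = 2 ^ ((-γ - δ - 4) / 2) := by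
    rw [show (1 / 4 : ℝ) = 2 ^ (-2 : ℝ) by rw [Real.rpow_neg two_pos.le, Real.rpow_two]; norm_num,
      ← Real.rpow_add two_pos, ← Real.rpow_add two_pos, ← Real.rpow_add two_pos]
    congr 1
    ring
  have h3 : √(1 - ρ ^ 2) ^ (1 - (y.n : ℝ)) * ((1 - ρ ^ 2) ^ ((y.n - γ - 1) / 2) *
      (1 - ρ ^ 2) ^ ((y.n - δ - 1) / 2)) = (1 - ρ ^ 2) ^ ((y.n - γ - δ - 1) / 2) := by
    rw [Real.sqrt_eq_rpow, ← Real.rpow_mul hρ.le, ← Real.rpow_add hρ, ← Real.rpow_add hρ]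
    congr 1
    ring
  rw [hs _ _ hs1, hs _ _ hs2, nullConst, Real.mul_rpow (by positivity) (by positivity),
    Real.mul_rpow (by positivity) (by positivity), ← h2,
    show (1 + γ - y.n) / 2 = -((y.n - γ - 1) / 2) by ring,
    show (1 + δ - y.n) / 2 = -((y.n - δ - 1) / 2) by ring]
  calc _ = 2 ^ (1 - (y.n : ℝ)) * (1 / 4) * (2 ^ ((y.n - γ - 1) / 2) *
        2 ^ ((y.n - δ - 1) / 2)) * (Real.pi ^ (1 - (y.n : ℝ)) / y.n) *
        (y.n * y.s1 ^ 2) ^ (-((y.n - γ - 1) / 2)) * (y.n * y.s2 ^ 2) ^ (-((y.n - δ - 1) / 2)) *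
        (gammaSeries ((y.n - γ - 1) / 2) ((y.n - δ - 1) / 2) (y.r * ρ) *
        (√(1 - ρ ^ 2) ^ (1 - (y.n : ℝ)) * ((1 - ρ ^ 2) ^ ((y.n - γ - 1) / 2) *
          (1 - ρ ^ 2) ^ ((y.n - δ - 1) / 2)))) := by ring
    _ = _ := by rw [h3, hG]; ring

theorem abs_mul_lt_one {r ρ : ℝ} (hr : |r| < 1) (hρ : ρ ∈ Ioo (-1 : ℝ) 1) : |r * ρ| < 1 := by
  rw [abs_mul]
  exact (mul_le_of_le_one_right (abs_nonneg r) (abs_lt.2 hρ).le).trans_lt hr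

/-- Since `B` is odd, the sign of `A + B` is not evident from the formula; it follows from the
representation as an integral of a nonnegative function. -/
theorem const_mul_reducedLikelihood_nonneg (y : Summary) {γ δ ρ : ℝ} (hn : 0 < y.n)
    (hs1 : 0 < y.s1) (hs2 : 0 < y.s2) (hr : |y.r| < 1) (hγ : γ + 1 < (y.n : ℝ))
    (hδ : δ + 1 < (y.n : ℝ)) (hρ : ρ ∈ Ioo (-1 : ℝ) 1) :
    0 ≤ nullConst y γ δ * reducedLikelihood y.n y.r γ δ ρ := by
  have hn' : (0 : ℝ) < y.n := by exact_mod_cast hn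
  have hρ' := one_sub_sq_pos hρ
  rw [← const_mul_reducedLikelihood y hn hs1 hs2 hγ hδ hρ', ← integral_scaleIntegrand
    (by linarith) (by linarith) (by positivity) hs1 hs2 (abs_mul_lt_one hr hρ)]
  refine mul_nonneg (by positivity) ?_
  exact setIntegral_nonneg (measurableSet_Ioi.prod measurableSet_Ioi)
    fun σ hσ => scaleIntegrand_nonneg hσ

theorem lintegral_nuisance (y : Summary) {γ δ ρ : ℝ} (hn : 0 < y.n) (hs1 : 0 < y.s1)
    (hs2 : 0 < y.s2) (hr : |y.r| < 1) (hγ : γ + 1 < (y.n : ℝ)) (hδ : δ + 1 < (y.n : ℝ))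
    (hρ : ρ ∈ Ioo (-1 : ℝ) 1) :
    ∫⁻ θ₀ in nuisanceSet, ENNReal.ofReal (likelihood y θ₀ ρ * priorNuisance γ δ θ₀) =
      ENNReal.ofReal (nullConst y γ δ * reducedLikelihood y.n y.r γ δ ρ) := by
  have hn' : (0 : ℝ) < y.n := by exact_mod_cast hn
  have hρ' := one_sub_sq_pos hρ
  have hS : MeasurableSet (Ioi (0 : ℝ) ×ˢ Ioi (0 : ℝ)) := measurableSet_Ioi.prod measurableSet_Ioi
  have hm : Measurable fun θ₀ : Nuisance =>
      ENNReal.ofReal (likelihood y θ₀ ρ * priorNuisance γ δ θ₀) :=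
    (((measurable_likelihood y).comp (by fun_prop : Measurable fun θ₀ : Nuisance => (θ₀, ρ))).mul
      (measurable_priorNuisance γ δ)).ennreal_ofReal
  -- Tonelli with the means innermost; no integrability is needed beforehand.
  rw [volume_restrict_nuisanceSet, lintegral_prod_symm _ hm.aemeasurable,
    lintegral_prod_symm _ hm.lintegral_prod_left'.aemeasurable]
  have key : ∀ σ ∈ Ioi (0 : ℝ) ×ˢ Ioi (0 : ℝ), ∫⁻ μ2 : ℝ, ∫⁻ μ1 : ℝ,
      ENNReal.ofReal (likelihood y (μ1, μ2, σ) ρ * priorNuisance γ δ (μ1, μ2, σ)) =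
      ENNReal.ofReal ((2 * Real.pi * √(1 - ρ ^ 2)) ^ (1 - (y.n : ℝ)) / y.n *
        scaleIntegrand ((y.n - γ - 1) / 2) ((y.n - δ - 1) / 2) (y.n / (2 * (1 - ρ ^ 2)))
          y.s1 y.s2 (y.r * ρ) σ) := by
    rintro ⟨σ1, σ2⟩ ⟨hσ1, hσ2⟩
    have hσ1 : 0 < σ1 := hσ1
    have hσ2 : 0 < σ2 := hσ2
    have h := lintegral_bivariate_gaussian
      (A := ((2 * Real.pi * σ1 * σ2 * √(1 - ρ ^ 2)) ^ y.n)⁻¹ *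
        Real.exp (-(y.n / (2 * (1 - ρ ^ 2))) * ((y.s1 / σ1) ^ 2
          - 2 * ρ * (y.r * y.s1 * y.s2 / (σ1 * σ2)) + (y.s2 / σ2) ^ 2)) *
        (σ1 ^ (γ - 1) * σ2 ^ (δ - 1))) (κ := y.n / (2 * (1 - ρ ^ 2)))
      (by positivity) (by positivity) hσ1 hσ2 hρ' y.xbar1 y.xbar2
    rw [scale_prefactor y hn hσ1 hσ2 hρ'] at h
    rw [scaleIntegrand, show 2 * (y.r * ρ) * (y.s1 * y.s2 / (σ1 * σ2)) =
      2 * ρ * (y.r * y.s1 * y.s2 / (σ1 * σ2)) by ring, ← h]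
    refine lintegral_congr fun μ2 => lintegral_congr fun μ1 => ?_
    simp only [likelihood, priorNuisance]
    congr 1
    ring
  rw [setLIntegral_congr_fun hS key, ← ofReal_integral_eq_lintegral_ofReal, integral_const_mul,
    integral_scaleIntegrand (by linarith) (by linarith) (by positivity) hs1 hs2
      (abs_mul_lt_one hr hρ), const_mul_reducedLikelihood y hn hs1 hs2 hγ hδ hρ']
  · exact (integrableOn_scaleIntegrand (by linarith) (by linarith) (by positivity) hs1 hs2
      (abs_mul_lt_one hr hρ)).const_mul _
  · exact ae_restrict_of_forall_mem hS fun σ hσ =>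
      mul_nonneg (by positivity) (scaleIntegrand_nonneg hσ)

/-! ### The even and odd parts against the prior -/

theorem rpow_mul_priorRho (C α β u : ℝ) {ρ : ℝ} (hρ : ρ ∈ Ioo (-1 : ℝ) 1) :
    (1 - ρ ^ 2) ^ u * priorRho C α β ρ = C⁻¹ * rhoWeight (α + u) β ρ := by
  rw [priorRho, rhoWeight, show α + u - 1 = u + (α - 1) by ring,
    Real.rpow_add (one_sub_sq_pos hρ)]
  ring

theorem pow_mul_partA_mul_priorRho (n : ℕ) (r C α β γ δ : ℝ) (k : ℕ) {ρ : ℝ}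
    (hρ : ρ ∈ Ioo (-1 : ℝ) 1) :
    ρ ^ k * partA n r γ δ ρ * priorRho C α β ρ = C⁻¹ *
      (ρ ^ k * gauss2F1 ((n - γ - 1) / 2) ((n - δ - 1) / 2) (1 / 2) (r ^ 2 * ρ ^ 2) *
        rhoWeight (α + (n - γ - δ - 1) / 2) β ρ) := by
  linear_combination (ρ ^ k * gauss2F1 ((n - γ - 1) / 2) ((n - δ - 1) / 2) (1 / 2)
    (r ^ 2 * ρ ^ 2)) * rpow_mul_priorRho C α β ((n - γ - δ - 1) / 2) hρ +
    ρ ^ k * priorRho C α β ρ * partA.eq_1 n r γ δ ρ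

theorem pow_mul_partB_mul_priorRho (n : ℕ) (r C α β γ δ : ℝ) (k : ℕ) {ρ : ℝ}
    (hρ : ρ ∈ Ioo (-1 : ℝ) 1) :
    ρ ^ k * partB n r γ δ ρ * priorRho C α β ρ = 2 * ratioW n γ δ * C⁻¹ * r *
      (ρ ^ (k + 1) * gauss2F1 ((n - γ) / 2) ((n - δ) / 2) (3 / 2) (r ^ 2 * ρ ^ 2) *
        rhoWeight (α + (n - γ - δ - 1) / 2) β ρ) := by
  linear_combination (2 * r * ratioW n γ δ * ρ ^ (k + 1) *
    gauss2F1 ((n - γ) / 2) ((n - δ) / 2) (3 / 2) (r ^ 2 * ρ ^ 2)) *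
    rpow_mul_priorRho C α β ((n - γ - δ - 1) / 2) hρ +
    ρ ^ k * priorRho C α β ρ * partB.eq_1 n r γ δ ρ

theorem intervalIntegrable_pow_mul_partA {n : ℕ} {r α γ δ : ℝ} (C β : ℝ) (hr : |r| < 1)
    (hη : γ + δ - 2 * α + 1 < (n : ℝ)) (k : ℕ) :
    IntervalIntegrable (fun ρ => ρ ^ k * partA n r γ δ ρ * priorRho C α β ρ) volume (-1) 1 :=
  intervalIntegrable_congr_Ioo (fun _ hρ => pow_mul_partA_mul_priorRho n r C α β γ δ k hρ)
    ((intervalIntegrable_mul_gauss2F1_mul_rhoWeight _ _ β (by norm_num) (by linarith) hr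
      (continuous_pow k)).const_mul _)

theorem intervalIntegrable_pow_mul_partB {n : ℕ} {r α γ δ : ℝ} (C β : ℝ) (hr : |r| < 1)
    (hη : γ + δ - 2 * α + 1 < (n : ℝ)) (k : ℕ) :
    IntervalIntegrable (fun ρ => ρ ^ k * partB n r γ δ ρ * priorRho C α β ρ) volume (-1) 1 :=
  intervalIntegrable_congr_Ioo (fun _ hρ => pow_mul_partB_mul_priorRho n r C α β γ δ k hρ)
    ((intervalIntegrable_mul_gauss2F1_mul_rhoWeight _ _ β (by norm_num) (by linarith) hr
      (continuous_pow (k + 1))).const_mul _)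

theorem integral_pow_mul_partA_of_odd (n : ℕ) (r C α β γ δ : ℝ) {k : ℕ} (hk : Odd k) :
    ∫ ρ in (-1 : ℝ)..1, ρ ^ k * partA n r γ δ ρ * priorRho C α β ρ = 0 :=
  integral_eq_zero_of_odd fun x => by simp [partA, priorRho, hk.neg_pow]

theorem integral_pow_mul_partB_of_even (n : ℕ) (r C α β γ δ : ℝ) {k : ℕ} (hk : Even k) :
    ∫ ρ in (-1 : ℝ)..1, ρ ^ k * partB n r γ δ ρ * priorRho C α β ρ = 0 :=
  integral_eq_zero_of_odd fun x => by simp [partB, priorRho, hk.neg_pow]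

theorem evenCoeff_eq (n : ℕ) (α β γ δ : ℝ) (k m : ℕ) :
    evenCoeff n α β γ δ k m = gaussCoeff ((n - γ - 1) / 2) ((n - δ - 1) / 2) (1 / 2) m *
      eulerValue β (α + (n - γ - δ - 1) / 2) ((k + 1) / 2 + m) := by
  rw [evenCoeff, coeffa, gaussCoeff, eulerValue,
    show (1 : ℝ) / 2 + (k + 2 * m) / 2 = (k + 1) / 2 + m by ring,
    show ((k : ℝ) + 2 * m + 1) / 2 = (k + 1) / 2 + m by ring,
    show ((k : ℝ) + 2 * m + 2 * α + n - γ - δ) / 2 =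
      (k + 1) / 2 + m + (α + (n - γ - δ - 1) / 2) by ring]

theorem oddCoeff_eq (n : ℕ) (α β γ δ : ℝ) (k m : ℕ) :
    oddCoeff n α β γ δ k m = gaussCoeff ((n - γ) / 2) ((n - δ) / 2) (3 / 2) m *
      eulerValue β (α + (n - γ - δ - 1) / 2) ((k + 2) / 2 + m) := by
  rw [oddCoeff, coeffb, gaussCoeff, eulerValue,
    show (1 : ℝ) / 2 + (k + 2 * m + 1) / 2 = (k + 2) / 2 + m by ring,
    show ((k : ℝ) + 2 * m + 2) / 2 = (k + 2) / 2 + m by ring,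
    show ((k : ℝ) + 2 * m + 2 * α + n - γ - δ + 1) / 2 =
      (k + 2) / 2 + m + (α + (n - γ - δ - 1) / 2) by ring]

theorem hasSum_evenCoeff {n : ℕ} {r α γ δ : ℝ} (β : ℝ) {C : ℝ} (hC : C ≠ 0) (hr : |r| < 1)
    (hγ : γ + 1 < (n : ℝ)) (hδ : δ + 1 < (n : ℝ)) (hη : γ + δ - 2 * α + 1 < (n : ℝ)) {k : ℕ}
    (hk : Even k) :
    HasSum (fun m => evenCoeff n α β γ δ k m * r ^ (2 * m))
      (C * ∫ ρ in (-1 : ℝ)..1, ρ ^ k * partA n r γ δ ρ * priorRho C α β ρ) := by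
  obtain ⟨l, rfl⟩ := hk.two_dvd
  rw [intervalIntegral_congr_Ioo
    (fun _ hρ => pow_mul_partA_mul_priorRho n r C α β γ δ (2 * l) hρ),
    intervalIntegral.integral_const_mul, mul_inv_cancel_left₀ hC]
  convert! hasSum_integral_gauss2F1 β (by linarith : 0 < (n - γ - 1) / 2)
    (by linarith : 0 < (n - δ - 1) / 2) (by norm_num : (0 : ℝ) < 1 / 2)
    (by linarith : 0 < α + (n - γ - δ - 1) / 2) hr l using 2 with m
  rw [evenCoeff_eq]
  congr 3
  push_cast
  ring

/-- The factor `ρ` in `B` makes `ρ^(2l+1) B` even, so the even-power series applies with `l + 1`;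
the factor `r` of `B` raises `r^(2m)` to `r^(2m+1)`. -/
theorem hasSum_oddCoeff {n : ℕ} {r α γ δ : ℝ} (β : ℝ) {C : ℝ} (hC : C ≠ 0) (hr : |r| < 1)
    (hγ : γ + 1 < (n : ℝ)) (hδ : δ + 1 < (n : ℝ)) (hη : γ + δ - 2 * α + 1 < (n : ℝ)) {k : ℕ}
    (hk : Odd k) : ∃ S : ℝ, HasSum (fun m => oddCoeff n α β γ δ k m * r ^ (2 * m + 1)) S ∧
      C * ∫ ρ in (-1 : ℝ)..1, ρ ^ k * partB n r γ δ ρ * priorRho C α β ρ =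
        2 * ratioW n γ δ * S := by
  obtain ⟨l, rfl⟩ := hk
  have h := (hasSum_integral_gauss2F1 β (by linarith : 0 < (n - γ) / 2)
    (by linarith : 0 < (n - δ) / 2) (by norm_num : (0 : ℝ) < 3 / 2)
    (by linarith : 0 < α + (n - γ - δ - 1) / 2) hr (l + 1)).mul_left r
  have hterm (m : ℕ) : oddCoeff n α β γ δ (2 * l + 1) m * r ^ (2 * m + 1) =
      r * (gaussCoeff ((n - γ) / 2) ((n - δ) / 2) (3 / 2) m *
        eulerValue β (α + (n - γ - δ - 1) / 2) ((l + 1 : ℕ) + 1 / 2 + m) * r ^ (2 * m)) := by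
    rw [oddCoeff_eq, pow_succ, show (((2 * l + 1 : ℕ) : ℝ) + 2) / 2 + m =
      ((l + 1 : ℕ) : ℝ) + 1 / 2 + m by push_cast; ring]
    ring
  refine ⟨_, by simpa only [hterm] using h, ?_⟩
  rw [intervalIntegral_congr_Ioo
      (fun _ hρ => pow_mul_partB_mul_priorRho n r C α β γ δ (2 * l + 1) hρ),
      intervalIntegral.integral_const_mul, show 2 * l + 1 + 1 = 2 * (l + 1) by ring]
  field_simp

theorem priorRho_pos {C α β ρ : ℝ} (hC : 0 < C) (hρ : ρ ∈ Ioo (-1 : ℝ) 1) :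
    0 < priorRho C α β ρ :=
  div_pos (rhoWeight_pos hρ) hC

theorem partA_pos {n : ℕ} {r γ δ ρ : ℝ} (hr : |r| < 1) (hγ : γ + 1 < (n : ℝ))
    (hδ : δ + 1 < (n : ℝ)) (hρ : ρ ∈ Ioo (-1 : ℝ) 1) : 0 < partA n r γ δ ρ := by
  have h := one_le_gauss2F1 (by linarith : 0 < (n - γ - 1) / 2)
    (by linarith : 0 < (n - δ - 1) / 2) (by norm_num : (0 : ℝ) < 1 / 2)
    (by positivity : 0 ≤ r ^ 2 * ρ ^ 2)
    ((le_abs_self _).trans_lt (sq_mul_sq_lt_one hr (Ioo_subset_Icc_self hρ)))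
  exact mul_pos (Real.rpow_pos_of_pos (one_sub_sq_pos hρ) _) (by linarith)

/-- Positivity is read off from the integral of a positive weight, not from the hypergeometric value
at `-1`. -/
theorem eulerValue_half_pos (β : ℝ) {e : ℝ} (he : 0 < e) : 0 < eulerValue β e (1 / 2) := by
  have h := integral_pow_mul_rhoWeight β he 0
  simp only [mul_zero, pow_zero, one_mul, Nat.cast_zero, zero_add] at h
  rw [← h]
  exact intervalIntegral.intervalIntegral_pos_of_pos_on (intervalIntegrable_rhoWeight β he)
    (fun ρ hρ => rhoWeight_pos hρ) (by norm_num)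

theorem priorConst_eq (α β : ℝ) : priorConst α β = eulerValue β α (1 / 2) := by
  rw [priorConst, eulerValue, add_comm α]

theorem integral_priorRho_priorConst {α : ℝ} (β : ℝ) (hα : 0 < α) :
    ∫ ρ in (-1 : ℝ)..1, priorRho (priorConst α β) α β ρ = 1 := by
  have h := integral_pow_mul_rhoWeight β hα 0
  simp only [mul_zero, pow_zero, one_mul, Nat.cast_zero, zero_add] at h
  have h2 : ∀ ρ, priorRho (priorConst α β) α β ρ = rhoWeight α β ρ / eulerValue β α (1 / 2) :=
    fun ρ => by rw [priorRho, priorConst_eq, rhoWeight]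
  simp_rw [h2]
  rw [intervalIntegral.integral_div, h, div_self (eulerValue_half_pos β hα).ne']

/-! ### The normalizing constant -/

theorem normConst_eq_integral_partA {n : ℕ} {r α γ δ : ℝ} (C β : ℝ) (hr : |r| < 1)
    (hη : γ + δ - 2 * α + 1 < (n : ℝ)) :
    normConst n r C α β γ δ = ∫ ρ in (-1 : ℝ)..1, partA n r γ δ ρ * priorRho C α β ρ := by
  have hA := intervalIntegrable_pow_mul_partA C β hr hη 0
  have hB := intervalIntegrable_pow_mul_partB C β hr hη 0
  have h0 := integral_pow_mul_partB_of_even n r C α β γ δ Even.zero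
  simp only [pow_zero, one_mul] at hA hB h0
  simp only [normConst, reducedLikelihood, add_mul]
  rw [intervalIntegral.integral_add hA hB, h0, add_zero]

theorem normConst_pos {n : ℕ} {r α γ δ C : ℝ} (β : ℝ) (hC : 0 < C) (hr : |r| < 1)
    (hγ : γ + 1 < (n : ℝ)) (hδ : δ + 1 < (n : ℝ)) (hη : γ + δ - 2 * α + 1 < (n : ℝ)) :
    0 < normConst n r C α β γ δ := by
  rw [normConst_eq_integral_partA C β hr hη]
  have hA := intervalIntegrable_pow_mul_partA C β hr hη 0
  simp only [pow_zero, one_mul] at hA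
  exact intervalIntegral.intervalIntegral_pos_of_pos_on hA
    (fun ρ hρ => mul_pos (partA_pos hr hγ hδ hρ) (priorRho_pos hC hρ)) (by norm_num)

theorem integrableOn_reducedLikelihood {n : ℕ} {r α γ δ : ℝ} (C β : ℝ) (hr : |r| < 1)
    (hη : γ + δ - 2 * α + 1 < (n : ℝ)) :
    IntegrableOn (fun ρ => reducedLikelihood n r γ δ ρ * priorRho C α β ρ) (Ioo (-1) 1) := by
  rw [← intervalIntegrable_iff_integrableOn_Ioo_of_le (by norm_num)]
  have h := (intervalIntegrable_pow_mul_partA C β hr hη 0).add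
    (intervalIntegrable_pow_mul_partB C β hr hη 0)
  simpa only [pow_zero, one_mul, ← add_mul] using! h

theorem nullConst_pos (y : Summary) {γ δ : ℝ} (hn : 0 < y.n) (hs1 : 0 < y.s1) (hs2 : 0 < y.s2)
    (hγ : γ + 1 < (y.n : ℝ)) (hδ : δ + 1 < (y.n : ℝ)) : 0 < nullConst y γ δ := by
  have hn' : (0 : ℝ) < y.n := by exact_mod_cast hn
  have hga := Real.Gamma_pos_of_pos (by linarith : 0 < (y.n - γ - 1) / 2)
  have hgb := Real.Gamma_pos_of_pos (by linarith : 0 < (y.n - δ - 1) / 2)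
  unfold nullConst
  positivity

theorem reducedLikelihood_zero (n : ℕ) (r γ δ : ℝ) : reducedLikelihood n r γ δ 0 = 1 := by
  have h := gauss2F1_eq_ordinaryHypergeometric ((n - γ - 1) / 2) ((n - δ - 1) / 2)
    (by norm_num : (0 : ℝ) < 1 / 2) (by simp : |(0 : ℝ)| < 1)
  rw [ordinaryHypergeometric_zero] at h
  simpa [reducedLikelihood, partA, partB] using h

/-! ### The marginal likelihood and the marginal posterior -/

section Summary

variable {y : Summary} {α γ δ : ℝ}

theorem reducedLikelihood_nonneg (hn : 0 < y.n) (hr : |y.r| < 1) (hs1 : 0 < y.s1)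
    (hs2 : 0 < y.s2) (hγ : γ + 1 < (y.n : ℝ)) (hδ : δ + 1 < (y.n : ℝ)) {ρ : ℝ}
    (hρ : ρ ∈ Ioo (-1 : ℝ) 1) : 0 ≤ reducedLikelihood y.n y.r γ δ ρ :=
  nonneg_of_mul_nonneg_right (const_mul_reducedLikelihood_nonneg y hn hs1 hs2 hr hγ hδ hρ)
    (nullConst_pos y hn hs1 hs2 hγ hδ)

theorem measurable_nullIntegrand (y : Summary) (γ δ ρ : ℝ) :
    Measurable fun θ₀ : Nuisance => likelihood y θ₀ ρ * priorNuisance γ δ θ₀ :=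
  ((measurable_likelihood y).comp (by fun_prop : Measurable fun θ₀ : Nuisance => (θ₀, ρ))).mul
    (measurable_priorNuisance γ δ)

theorem measurable_joint (y : Summary) (C α β γ δ : ℝ) : Measurable (joint y C α β γ δ) := by
  have h : Measurable (priorRho C α β) := by unfold priorRho; fun_prop
  exact (measurable_likelihood y).mul
    ((h.comp measurable_snd).mul ((measurable_priorNuisance γ δ).comp measurable_fst))

theorem measurableSet_nuisanceSet : MeasurableSet nuisanceSet :=
  MeasurableSet.univ.prod (MeasurableSet.univ.prod (measurableSet_Ioi.prod measurableSet_Ioi))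

theorem integrableOn_nullIntegrand (hn : 0 < y.n) (hs1 : 0 < y.s1) (hs2 : 0 < y.s2)
    (hr : |y.r| < 1) (hγ : γ + 1 < (y.n : ℝ)) (hδ : δ + 1 < (y.n : ℝ)) :
    IntegrableOn (fun θ₀ => likelihood y θ₀ 0 * priorNuisance γ δ θ₀) nuisanceSet := by
  refine (lintegral_ofReal_ne_top_iff_integrable
    (measurable_nullIntegrand y γ δ 0).aestronglyMeasurable
    (ae_restrict_of_forall_mem measurableSet_nuisanceSet fun θ₀ h =>
      likelihood_mul_priorNuisance_nonneg y γ δ 0 h)).1 ?_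
  rw [lintegral_nuisance y hn hs1 hs2 hr hγ hδ (by simp)]
  exact ENNReal.ofReal_ne_top

theorem nullMarginalLikelihood_eq (hn : 0 < y.n) (hs1 : 0 < y.s1) (hs2 : 0 < y.s2)
    (hr : |y.r| < 1) (hγ : γ + 1 < (y.n : ℝ)) (hδ : δ + 1 < (y.n : ℝ)) :
    nullMarginalLikelihood y γ δ = nullConst y γ δ := by
  rw [nullMarginalLikelihood, integral_eq_lintegral_of_nonneg_ae
    (ae_restrict_of_forall_mem measurableSet_nuisanceSet fun θ₀ h =>
      likelihood_mul_priorNuisance_nonneg y γ δ 0 h)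
    (measurable_nullIntegrand y γ δ 0).aestronglyMeasurable,
    lintegral_nuisance y hn hs1 hs2 hr hγ hδ (by simp), reducedLikelihood_zero, mul_one,
    ENNReal.toReal_ofReal (nullConst_pos y hn hs1 hs2 hγ hδ).le]

theorem joint_nonneg {C : ℝ} (hC : 0 < C) (y : Summary) (α β γ δ : ℝ) {θ : Nuisance × ℝ}
    (hθ : θ ∈ paramSet) : 0 ≤ joint y C α β γ δ θ := by
  have h1 := likelihood_mul_priorNuisance_nonneg y γ δ θ.2 hθ.1
  have h2 := (priorRho_pos (α := α) (β := β) hC hθ.2).le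
  rw [joint, mul_left_comm]
  positivity

/-- The divisor `D` lets one statement serve twice: `D = 1` for the marginal likelihood, and `D` the
marginal likelihood itself for the posterior density. -/
theorem lintegral_nuisance_joint {C : ℝ} (β : ℝ) (hn : 0 < y.n) (hs1 : 0 < y.s1) (hs2 : 0 < y.s2)
    (hr : |y.r| < 1) (hγ : γ + 1 < (y.n : ℝ)) (hδ : δ + 1 < (y.n : ℝ)) (hC : 0 < C) {D : ℝ}
    (hD : 0 < D) {ρ : ℝ} (hρ : ρ ∈ Ioo (-1 : ℝ) 1) :
    ∫⁻ θ₀ in nuisanceSet, ENNReal.ofReal (joint y C α β γ δ (θ₀, ρ) / D) =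
      ENNReal.ofReal (nullConst y γ δ *
        (reducedLikelihood y.n y.r γ δ ρ * priorRho C α β ρ) / D) := by
  have hπ := priorRho_pos (α := α) (β := β) hC hρ
  have h : ∀ θ₀, ENNReal.ofReal (joint y C α β γ δ (θ₀, ρ) / D) =
      ENNReal.ofReal (priorRho C α β ρ / D) *
        ENNReal.ofReal (likelihood y θ₀ ρ * priorNuisance γ δ θ₀) := fun θ₀ => by
    rw [← ENNReal.ofReal_mul (by positivity), joint]
    congr 1
    ring
  simp_rw [h]
  rw [lintegral_const_mul _ (measurable_nullIntegrand y γ δ ρ).ennreal_ofReal,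
    lintegral_nuisance y hn hs1 hs2 hr hγ hδ hρ, ← ENNReal.ofReal_mul (by positivity)]
  congr 1
  ring

theorem volume_restrict_paramSet :
    (volume : Measure (Nuisance × ℝ)).restrict paramSet =
      ((volume : Measure Nuisance).restrict nuisanceSet).prod (volume.restrict (Ioo (-1) 1)) := by
  rw [paramSet, Measure.volume_eq_prod, Measure.prod_restrict]

theorem lintegral_joint {C : ℝ} (β : ℝ) (hn : 0 < y.n) (hs1 : 0 < y.s1) (hs2 : 0 < y.s2)
    (hr : |y.r| < 1) (hγ : γ + 1 < (y.n : ℝ)) (hδ : δ + 1 < (y.n : ℝ))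
    (hη : γ + δ - 2 * α + 1 < (y.n : ℝ)) (hC : 0 < C) :
    ∫⁻ θ in paramSet, ENNReal.ofReal (joint y C α β γ δ θ) =
      ENNReal.ofReal (nullConst y γ δ * normConst y.n y.r C α β γ δ) := by
  rw [volume_restrict_paramSet,
    lintegral_prod_symm _ (measurable_joint y C α β γ δ).ennreal_ofReal.aemeasurable]
  have h : ∀ ρ ∈ Ioo (-1 : ℝ) 1,
      ∫⁻ θ₀ in nuisanceSet, ENNReal.ofReal (joint y C α β γ δ (θ₀, ρ)) =
      ENNReal.ofReal (nullConst y γ δ *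
        (reducedLikelihood y.n y.r γ δ ρ * priorRho C α β ρ)) := fun ρ hρ => by
    simpa using lintegral_nuisance_joint (α := α) β hn hs1 hs2 hr hγ hδ hC one_pos hρ
  rw [setLIntegral_congr_fun measurableSet_Ioo h, ← ofReal_integral_eq_lintegral_ofReal,
    integral_const_mul, setIntegral_Ioo_eq_intervalIntegral, normConst]
  · exact (integrableOn_reducedLikelihood C β hr hη).const_mul _
  · refine ae_restrict_of_forall_mem measurableSet_Ioo fun ρ hρ => ?_
    exact mul_nonneg (nullConst_pos y hn hs1 hs2 hγ hδ).le
      (mul_nonneg (reducedLikelihood_nonneg hn hr hs1 hs2 hγ hδ hρ) (priorRho_pos hC hρ).le)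

theorem measurableSet_paramSet : MeasurableSet paramSet :=
  measurableSet_nuisanceSet.prod measurableSet_Ioo

theorem integrableOn_joint {C : ℝ} (β : ℝ) (hn : 0 < y.n) (hs1 : 0 < y.s1) (hs2 : 0 < y.s2)
    (hr : |y.r| < 1) (hγ : γ + 1 < (y.n : ℝ)) (hδ : δ + 1 < (y.n : ℝ))
    (hη : γ + δ - 2 * α + 1 < (y.n : ℝ)) (hC : 0 < C) :
    IntegrableOn (joint y C α β γ δ) paramSet := by
  refine (lintegral_ofReal_ne_top_iff_integrable
    (measurable_joint y C α β γ δ).aestronglyMeasurable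
    (ae_restrict_of_forall_mem measurableSet_paramSet fun θ hθ =>
      joint_nonneg hC y α β γ δ hθ)).1 ?_
  rw [lintegral_joint β hn hs1 hs2 hr hγ hδ hη hC]
  exact ENNReal.ofReal_ne_top

theorem marginalLikelihood_eq {C : ℝ} (β : ℝ) (hn : 0 < y.n) (hs1 : 0 < y.s1) (hs2 : 0 < y.s2)
    (hr : |y.r| < 1) (hγ : γ + 1 < (y.n : ℝ)) (hδ : δ + 1 < (y.n : ℝ))
    (hη : γ + δ - 2 * α + 1 < (y.n : ℝ)) (hC : 0 < C) :
    marginalLikelihood y C α β γ δ = nullConst y γ δ * normConst y.n y.r C α β γ δ := by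
  rw [marginalLikelihood, integral_eq_lintegral_of_nonneg_ae
    (ae_restrict_of_forall_mem measurableSet_paramSet fun θ hθ =>
      joint_nonneg hC y α β γ δ hθ)
    (measurable_joint y C α β γ δ).aestronglyMeasurable,
    lintegral_joint β hn hs1 hs2 hr hγ hδ hη hC, ENNReal.toReal_ofReal]
  exact mul_nonneg (nullConst_pos y hn hs1 hs2 hγ hδ).le (normConst_pos β hC hr hγ hδ hη).le

theorem marginalPosterior_eq {C : ℝ} (β : ℝ) (hn : 0 < y.n) (hs1 : 0 < y.s1) (hs2 : 0 < y.s2)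
    (hr : |y.r| < 1) (hγ : γ + 1 < (y.n : ℝ)) (hδ : δ + 1 < (y.n : ℝ))
    (hη : γ + δ - 2 * α + 1 < (y.n : ℝ)) (hC : 0 < C) :
    marginalPosterior y C α β γ δ =
      (volume.restrict (Ioo (-1) 1)).withDensity (fun ρ => ENNReal.ofReal
        (reducedLikelihood y.n y.r γ δ ρ * priorRho C α β ρ / normConst y.n y.r C α β γ δ)) := by
  have hK := nullConst_pos y hn hs1 hs2 hγ hδ
  have hp := normConst_pos β hC hr hγ hδ hη
  ext S hS
  -- The preimage of `S` is `univ ×ˢ S`, so Tonelli integrates out all nuisance parameters over each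
  -- `ρ` in `S`; `nullConst` then cancels against the factorized marginal likelihood.
  rw [marginalPosterior, Measure.map_apply measurable_snd hS, posterior,
    withDensity_apply _ (measurable_snd hS), withDensity_apply _ hS, volume_restrict_paramSet,
    ← univ_prod, ← Measure.prod_restrict, Measure.restrict_univ, lintegral_prod_symm _
      ((measurable_joint y C α β γ δ).div_const _).ennreal_ofReal.aemeasurable]
  refine lintegral_congr_ae (ae_restrict_of_ae
    (ae_restrict_of_forall_mem measurableSet_Ioo fun ρ hρ => ?_))
  beta_reduce
  rw [marginalLikelihood_eq β hn hs1 hs2 hr hγ hδ hη hC,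
    lintegral_nuisance_joint β hn hs1 hs2 hr hγ hδ hC (by positivity) hρ]
  congr 1
  field_simp

theorem density_nonneg {C : ℝ} (β : ℝ) (hn : 0 < y.n) (hs1 : 0 < y.s1) (hs2 : 0 < y.s2)
    (hr : |y.r| < 1) (hγ : γ + 1 < (y.n : ℝ)) (hδ : δ + 1 < (y.n : ℝ))
    (hη : γ + δ - 2 * α + 1 < (y.n : ℝ)) (hC : 0 < C) {ρ : ℝ} (hρ : ρ ∈ Ioo (-1 : ℝ) 1) :
    0 ≤ reducedLikelihood y.n y.r γ δ ρ * priorRho C α β ρ / normConst y.n y.r C α β γ δ :=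
  div_nonneg (mul_nonneg (reducedLikelihood_nonneg hn hr hs1 hs2 hγ hδ hρ)
    (priorRho_pos hC hρ).le) (normConst_pos β hC hr hγ hδ hη).le

theorem isProbabilityMeasure_marginalPosterior {C : ℝ} (β : ℝ) (hn : 0 < y.n) (hs1 : 0 < y.s1)
    (hs2 : 0 < y.s2) (hr : |y.r| < 1) (hγ : γ + 1 < (y.n : ℝ)) (hδ : δ + 1 < (y.n : ℝ))
    (hη : γ + δ - 2 * α + 1 < (y.n : ℝ)) (hC : 0 < C) :
    IsProbabilityMeasure (marginalPosterior y C α β γ δ) := by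
  have hp := normConst_pos β hC hr hγ hδ hη
  constructor
  rw [marginalPosterior_eq β hn hs1 hs2 hr hγ hδ hη hC, withDensity_apply _ MeasurableSet.univ,
    Measure.restrict_univ, ← ofReal_integral_eq_lintegral_ofReal, integral_div,
    setIntegral_Ioo_eq_intervalIntegral, ← normConst, div_self hp.ne', ENNReal.ofReal_one]
  · exact (integrableOn_reducedLikelihood C β hr hη).div_const _
  · exact ae_restrict_of_forall_mem measurableSet_Ioo fun ρ hρ =>
      density_nonneg β hn hs1 hs2 hr hγ hδ hη hC hρ

theorem integrable_pow_marginalPosterior {C : ℝ} (β : ℝ) (hn : 0 < y.n) (hs1 : 0 < y.s1)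
    (hs2 : 0 < y.s2) (hr : |y.r| < 1) (hγ : γ + 1 < (y.n : ℝ)) (hδ : δ + 1 < (y.n : ℝ))
    (hη : γ + δ - 2 * α + 1 < (y.n : ℝ)) (hC : 0 < C) (k : ℕ) :
    Integrable (fun ρ : ℝ => ρ ^ k) (marginalPosterior y C α β γ δ) := by
  have := isProbabilityMeasure_marginalPosterior β hn hs1 hs2 hr hγ hδ hη hC
  refine Integrable.of_bound (by fun_prop) 1 ?_
  rw [marginalPosterior_eq β hn hs1 hs2 hr hγ hδ hη hC]
  refine (withDensity_absolutelyContinuous _ _).ae_le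
    (ae_restrict_of_forall_mem measurableSet_Ioo fun ρ hρ => ?_)
  rw [norm_pow]
  exact pow_le_one₀ (norm_nonneg ρ) (abs_lt.2 hρ).le

theorem posteriorMoment_eq {C : ℝ} (β : ℝ) (hn : 0 < y.n) (hs1 : 0 < y.s1)
    (hs2 : 0 < y.s2) (hr : |y.r| < 1) (hγ : γ + 1 < (y.n : ℝ)) (hδ : δ + 1 < (y.n : ℝ))
    (hη : γ + δ - 2 * α + 1 < (y.n : ℝ)) (hC : 0 < C) (k : ℕ) :
    posteriorMoment y C α β γ δ k = 1 / normConst y.n y.r C α β γ δ *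
      ((∫ ρ in (-1 : ℝ)..1, ρ ^ k * partA y.n y.r γ δ ρ * priorRho C α β ρ) +
        ∫ ρ in (-1 : ℝ)..1, ρ ^ k * partB y.n y.r γ δ ρ * priorRho C α β ρ) := by
  rw [posteriorMoment, marginalPosterior_eq β hn hs1 hs2 hr hγ hδ hη hC,
    integral_withDensity_eq_integral_toReal_smul₀
      ((integrableOn_reducedLikelihood C β hr hη).div_const _).aemeasurable.ennreal_ofReal
      (ae_of_all _ fun _ => ENNReal.ofReal_lt_top),
    ← intervalIntegral.integral_add (intervalIntegrable_pow_mul_partA C β hr hη k)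
      (intervalIntegrable_pow_mul_partB C β hr hη k),
    ← intervalIntegral.integral_const_mul, ← setIntegral_Ioo_eq_intervalIntegral]
  refine setIntegral_congr_fun measurableSet_Ioo fun ρ hρ => ?_
  rw [ENNReal.toReal_ofReal (density_nonneg β hn hs1 hs2 hr hγ hδ hη hC hρ), smul_eq_mul,
    reducedLikelihood]
  ring

end Summary

end CorrPosterior

open CorrPosterior in
/-- Characterization of the marginal posteriors of `ρ`. The scaling constant `C > 0` of the prior on
`ρ` is arbitrary: `C = C_{α,β}` gives the normalized prior when `α > 0`, and `C = 1` the
unnormalized one for every real `α`. -/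
theorem mainTheorem2 (y : Summary) (α β γ δ C : ℝ)
    (hn : 0 < y.n) (hs1 : 0 < y.s1) (hs2 : 0 < y.s2) (hr : |y.r| < 1)
    (hγ : γ + 1 < (y.n : ℝ)) (hδ : δ + 1 < (y.n : ℝ))
    (hη : γ + δ - 2 * α + 1 < (y.n : ℝ)) (hC : 0 < C) :
    -- `C_{α,β}` is the normalization constant of the prior on `ρ`, if that prior is proper
    (0 < α → 0 < priorConst α β ∧ ∫ ρ in (-1 : ℝ)..1, priorRho (priorConst α β) α β ρ = 1) ∧
    -- factorization of the marginal likelihood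
    (IntegrableOn (joint y C α β γ δ) paramSet ∧
      IntegrableOn (fun θ₀ => likelihood y θ₀ 0 * priorNuisance γ δ θ₀) nuisanceSet ∧
      nullMarginalLikelihood y γ δ =
        2 ^ ((-γ - δ - 4) / 2) * (Real.pi ^ (1 - (y.n : ℝ)) / y.n) *
          (y.n * y.s1 ^ 2) ^ ((1 + γ - y.n) / 2) * (y.n * y.s2 ^ 2) ^ ((1 + δ - y.n) / 2) *
          Real.Gamma ((y.n - γ - 1) / 2) * Real.Gamma ((y.n - δ - 1) / 2) ∧
      marginalLikelihood y C α β γ δ =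
        nullMarginalLikelihood y γ δ * normConst y.n y.r C α β γ δ) ∧
    -- the normalizing constant involves only the even part
    (0 < normConst y.n y.r C α β γ δ ∧
      IntervalIntegrable (fun ρ => partA y.n y.r γ δ ρ * priorRho C α β ρ) volume (-1) 1 ∧
      IntervalIntegrable (fun ρ => partB y.n y.r γ δ ρ * priorRho C α β ρ) volume (-1) 1 ∧
      normConst y.n y.r C α β γ δ =
        ∫ ρ in (-1 : ℝ)..1, partA y.n y.r γ δ ρ * priorRho C α β ρ ∧
      ∫ ρ in (-1 : ℝ)..1, partB y.n y.r γ δ ρ * priorRho C α β ρ = 0) ∧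
    -- it is the normalizing constant of the marginal posterior of `ρ`
    (IsProbabilityMeasure (marginalPosterior y C α β γ δ) ∧
      marginalPosterior y C α β γ δ =
        (volume.restrict (Set.Ioo (-1) 1)).withDensity (fun ρ => ENNReal.ofReal
          (reducedLikelihood y.n y.r γ δ ρ * priorRho C α β ρ / normConst y.n y.r C α β γ δ))) ∧
    -- the posterior moments, as integrals and as series
    (∀ k : ℕ, Integrable (fun ρ : ℝ => ρ ^ k) (marginalPosterior y C α β γ δ) ∧
      (Even k →
        posteriorMoment y C α β γ δ k = 1 / normConst y.n y.r C α β γ δ *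
          ∫ ρ in (-1 : ℝ)..1, ρ ^ k * partA y.n y.r γ δ ρ * priorRho C α β ρ) ∧
      (Odd k →
        posteriorMoment y C α β γ δ k = 1 / normConst y.n y.r C α β γ δ *
          ∫ ρ in (-1 : ℝ)..1, ρ ^ k * partB y.n y.r γ δ ρ * priorRho C α β ρ) ∧
      (Even k →
        Summable (fun m : ℕ => evenCoeff y.n α β γ δ k m * y.r ^ (2 * m)) ∧
        posteriorMoment y C α β γ δ k = 1 / (C * normConst y.n y.r C α β γ δ) *
          ∑' m : ℕ, evenCoeff y.n α β γ δ k m * y.r ^ (2 * m)) ∧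
      (Odd k →
        Summable (fun m : ℕ => oddCoeff y.n α β γ δ k m * y.r ^ (2 * m + 1)) ∧
        posteriorMoment y C α β γ δ k =
          2 * ratioW y.n γ δ / (C * normConst y.n y.r C α β γ δ) *
            ∑' m : ℕ, oddCoeff y.n α β γ δ k m * y.r ^ (2 * m + 1))) ∧
    -- the series are hypergeometric when `β / 2` is a non-negative integer
    ((∃ j : ℕ, β = 2 * j) → ∀ k : ℕ,
      (Even k → IsHypergeometricSeq (evenCoeff y.n α β γ δ k)) ∧
      (Odd k → IsHypergeometricSeq (oddCoeff y.n α β γ δ k))) := by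
  have hA := intervalIntegrable_pow_mul_partA C β hr hη 0
  have hB := intervalIntegrable_pow_mul_partB C β hr hη 0
  have hB0 := integral_pow_mul_partB_of_even y.n y.r C α β γ δ Even.zero
  simp only [pow_zero, one_mul] at hA hB hB0
  have hnull := nullMarginalLikelihood_eq hn hs1 hs2 hr hγ hδ
  have hp := normConst_pos β hC hr hγ hδ hη
  have he : 0 < α + (y.n - γ - δ - 1) / 2 := by linarith
  refine ⟨fun hα => ⟨?_, integral_priorRho_priorConst β hα⟩,
    ⟨integrableOn_joint β hn hs1 hs2 hr hγ hδ hη hC,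
      integrableOn_nullIntegrand hn hs1 hs2 hr hγ hδ, hnull, ?_⟩,
    ⟨hp, hA, hB, normConst_eq_integral_partA C β hr hη, hB0⟩,
    ⟨isProbabilityMeasure_marginalPosterior β hn hs1 hs2 hr hγ hδ hη hC,
      marginalPosterior_eq β hn hs1 hs2 hr hγ hδ hη hC⟩, fun k => ?_, ?_⟩
  · rw [priorConst_eq]
    exact eulerValue_half_pos β hα
  · rw [hnull, marginalLikelihood_eq β hn hs1 hs2 hr hγ hδ hη hC]
  · have hmom := posteriorMoment_eq β hn hs1 hs2 hr hγ hδ hη hC k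
    have hev : Even k → posteriorMoment y C α β γ δ k = 1 / normConst y.n y.r C α β γ δ *
        ∫ ρ in (-1 : ℝ)..1, ρ ^ k * partA y.n y.r γ δ ρ * priorRho C α β ρ := fun hk => by
      rw [hmom, integral_pow_mul_partB_of_even y.n y.r C α β γ δ hk, add_zero]
    have hodd : Odd k → posteriorMoment y C α β γ δ k = 1 / normConst y.n y.r C α β γ δ *
        ∫ ρ in (-1 : ℝ)..1, ρ ^ k * partB y.n y.r γ δ ρ * priorRho C α β ρ := fun hk => by
      rw [hmom, integral_pow_mul_partA_of_odd y.n y.r C α β γ δ hk, zero_add]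
    refine ⟨integrable_pow_marginalPosterior β hn hs1 hs2 hr hγ hδ hη hC k, hev, hodd,
      fun hk => ?_, fun hk => ?_⟩
    · have h := hasSum_evenCoeff β hC.ne' hr hγ hδ hη hk
      refine ⟨h.summable, ?_⟩
      rw [h.tsum_eq, hev hk]
      field_simp
    · obtain ⟨S, hS, hval⟩ := hasSum_oddCoeff β hC.ne' hr hγ hδ hη hk
      refine ⟨hS.summable, ?_⟩
      rw [hS.tsum_eq, hodd hk, div_mul_eq_mul_div (2 * ratioW y.n γ δ), ← hval]
      field_simp
  · rintro ⟨j, rfl⟩ k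
    refine ⟨fun _ => ?_, fun _ => ?_⟩
    · rw [funext (evenCoeff_eq y.n α (2 * j) γ δ k)]
      exact isHypergeometricSeq_gaussCoeff_mul_eulerValue _ _ (by norm_num) he (by positivity) j
    · rw [funext (oddCoeff_eq y.n α (2 * j) γ δ k)]
      exact isHypergeometricSeq_gaussCoeff_mul_eulerValue _ _ (by norm_num) he (by positivity) j
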